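/- Let $n\ge 3$, let $W=\mathbb{C}^n\setminus\{0\}$ and let $f(z_1,\dots,z_n)=(\mu_1z_1,\dots,\mu_nz_n)$ with $0<|\mu_i|<1$ for all $i$. Assume that the Hopf manifold $X=W/\langle f\rangle$, with projection $\pi:W\to X$, is generic: $|\mu_1|\le\dots\le|\mu_n|$, and a relation $\prod_{i\in A}\mu_i^{r_i}=\prod_{j\in B}\mu_j^{r_j}$ with $r_1,\dots,r_n\in\mathbb{Z}_{\ge 0}$, $A\cap B=\emptyset$ and $A\cup B=\{1,\dots,n\}$ holds only if $r_1=\dots=r_n=0$. Let $\mathcal{F}$ be a codimension-one holomorphic distribution, possibly singular, on $X$, that is, a nonzero holomorphic $1$-form on $X$ with values in a holomorphic line bundle; equivalently, an open cover $(U_i)$ of $X$ with holomorphic $1$-forms $\omega_i$ on $U_i$, not all identically zero, such that $\omega_i=g_{ij}\omega_j$ on $U_i\cap U_j$ with $g_{ij}$ holomorphic and nowhere vanishing. Then $\mathcal{F}$ is integrable, i.e. $\omega_i\wedge d\omega_i=0$ for all $i$. Moreover $\mathcal{F}$ is induced by a monomial $1$-form: there are $c_1,\dots,c_n\in\mathbb{C}$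 and $m_1,\dots,m_n\in\mathbb{Z}_{\ge 0}$, with $c_i=0$ whenever $m_i=0$, such that the holomorphic $1$-form $$\omega=\sum_{i=1}^n c_i\, z_1^{m_1}\cdots z_i^{m_i-1}\cdots z_n^{m_n}\,dz_i$$ is, on each $\pi^{-1}(U_i)$, the product of $\pi^*\omega_i$ and a nowhere vanishing holomorphic function; and $\omega\wedge d\omega=0$ on $W$. -/

import Mathlib

open Topology TopologicalSpace

noncomputable section

namespace Hopf

/-- The punctured space `W = ℂⁿ ∖ {0}`. -/
abbrev Punctured (n : ℕ) : Type := {z : Fin n → ℂ // z ≠ 0}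

/-- The data of a diagonal contraction `f (z₁, …, zₙ) = (μ₁ z₁, …, μₙ zₙ)` of `ℂⁿ`,
with `0 < |μᵢ| < 1` for all `i`. -/
structure DiagonalContraction (n : ℕ) where
  mult : Fin n → ℂ
  mult_ne_zero : ∀ i, mult i ≠ 0
  norm_mult_lt_one : ∀ i, ‖mult i‖ < 1

namespace DiagonalContraction

variable {n : ℕ} (F : DiagonalContraction n)

/-- The contraction `f` as a linear map of `ℂⁿ`; it is its own differential at every point. -/
def linear : (Fin n → ℂ) →L[ℂ] (Fin n → ℂ) :=
  ContinuousLinearMap.pi fun i => F.mult i • ContinuousLinearMap.proj i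

/-- The automorphism of `W` induced by `f`. -/
def perm : Equiv.Perm (Punctured n) where
  toFun z := ⟨fun i => F.mult i * z.1 i, fun h => z.2 (funext fun i =>
    (mul_eq_zero.mp (congrFun h i)).resolve_left (F.mult_ne_zero i))⟩
  invFun z := ⟨fun i => (F.mult i)⁻¹ * z.1 i, fun h => z.2 (funext fun i =>
    (mul_eq_zero.mp (congrFun h i)).resolve_left (inv_ne_zero (F.mult_ne_zero i)))⟩
  left_inv z := Subtype.ext (funext fun i => inv_mul_cancel_left₀ (F.mult_ne_zero i) (z.1 i))
  right_inv z := Subtype.ext (funext fun i => mul_inv_cancel_left₀ (F.mult_ne_zero i) (z.1 i))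

/-- There is no non-trivial relation `∏_{i ∈ A} μᵢ ^ rᵢ = ∏_{j ∈ B} μⱼ ^ rⱼ`, with natural exponents
(zero allowed), `A ∩ B = ∅` and `A ∪ B = {1, …, n}`; and `|μ₁| ≤ … ≤ |μₙ|`. -/
def IsGeneric : Prop :=
  Monotone (fun i => ‖F.mult i‖) ∧
  ∀ (A B : Finset (Fin n)) (r : Fin n → ℕ), Disjoint A B → A ∪ B = Finset.univ →
    ∏ i ∈ A, F.mult i ^ r i = ∏ j ∈ B, F.mult j ^ r j → ∀ i, r i = 0

/-- The Hopf manifold `X = W / ⟨f⟩`, the orbit space of the group generated by `f`. -/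
def HopfManifold : Type :=
  Quotient (MulAction.orbitRel (Subgroup.zpowers F.perm) (Punctured n))

/-- `X` carries the quotient topology. -/
instance : TopologicalSpace F.HopfManifold :=
  inferInstanceAs (TopologicalSpace (Quotient _))

/-- The projection `π : W → X`. -/
def proj (z : Punctured n) : F.HopfManifold := Quotient.mk _ z

/-- The open set `π⁻¹(U) ⊆ W`, seen as a subset of `ℂⁿ`. -/
def lift (U : Set F.HopfManifold) : Set (Fin n → ℂ) :=
  Subtype.val '' (F.proj ⁻¹' U)

/-- `φ` is a holomorphic function on the open set `U` of `X`: the complex structure of `X` is the one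
for which `π` is locally biholomorphic, so this means that `φ ∘ π` is holomorphic on `π⁻¹(U)`. -/
def IsHolomorphicOn (φ : F.HopfManifold → ℂ) (U : Set F.HopfManifold) : Prop :=
  ∃ ψ : (Fin n → ℂ) → ℂ, DifferentiableOn ℂ ψ (F.lift U) ∧
    ∀ z : Punctured n, F.proj z ∈ U → ψ z.1 = φ (F.proj z)

/-- A holomorphic `1`-form on the open set `U` of `X`, given by its pull-back under `π`: a
holomorphic `1`-form `α` on `π⁻¹(U)` with `f^* α = α`. Values off `π⁻¹(U)` are irrelevant. -/
structure HolOneForm (U : Opens F.HopfManifold) where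
  toFun : (Fin n → ℂ) → ((Fin n → ℂ) →L[ℂ] ℂ)
  holomorphic : DifferentiableOn ℂ toFun (F.lift U)
  invariant : ∀ z ∈ F.lift U, (toFun (F.linear z)).comp F.linear = toFun z

end DiagonalContraction

/-- The exterior derivative `dω` of a `1`-form on `ℂⁿ`, at `z`. -/
def dOneForm {n : ℕ} (ω : (Fin n → ℂ) → ((Fin n → ℂ) →L[ℂ] ℂ)) (z : Fin n → ℂ) :
    (Fin n → ℂ) [⋀^Fin 2]→L[ℂ] ℂ :=
  extDeriv (fun w => ContinuousAlternatingMap.ofSubsingleton ℂ (Fin n → ℂ) ℂ (0 : Fin 1) (ω w)) z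

/-- The value of the `3`-form `ω ∧ dω` at `z` on the vectors `u, v, w`. -/
def wedgeD {n : ℕ} (ω : (Fin n → ℂ) → ((Fin n → ℂ) →L[ℂ] ℂ)) (z u v w : Fin n → ℂ) : ℂ :=
  ω z u * dOneForm ω z ![v, w] - ω z v * dOneForm ω z ![u, w] + ω z w * dOneForm ω z ![u, v]

/-- `ω ∧ dω = 0` on the set `S`. -/
def IsIntegrableOn {n : ℕ} (ω : (Fin n → ℂ) → ((Fin n → ℂ) →L[ℂ] ℂ)) (S : Set (Fin n → ℂ)) : Prop :=
  ∀ z ∈ S, ∀ u v w, wedgeD ω z u v w = 0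

/-- A (possibly singular) holomorphic distribution of codimension one on the Hopf manifold `X`,
that is, a nonzero holomorphic `1`-form on `X` with values in a holomorphic line bundle `N`,
through local trivialisations of `N`: an open cover `Uᵢ` of `X` and holomorphic `1`-forms `ωᵢ` on
`Uᵢ`, not all identically zero, such that `ωᵢ = gᵢⱼ ωⱼ` on `Uᵢ ∩ Uⱼ` for a nowhere vanishing
holomorphic function `gᵢⱼ` there. The zeros of the `ωᵢ` are unrestricted. -/
structure CodimOneDistribution {n : ℕ} (F : DiagonalContraction n) where
  ι : Type*
  U : ι → Opens F.HopfManifold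
  cover : ∀ x, ∃ i, x ∈ U i
  form : ∀ i, F.HolOneForm (U i)
  nonzero : ∃ i, ∃ z ∈ F.lift (U i), (form i).toFun z ≠ 0
  transition : ∀ i j, ∃ g : F.HopfManifold → ℂ,
    F.IsHolomorphicOn g (U i ∩ U j : Set F.HopfManifold) ∧
    (∀ x, x ∈ U i → x ∈ U j → g x ≠ 0) ∧
    ∀ z : Punctured n, F.proj z ∈ U i → F.proj z ∈ U j →
      (form i).toFun z.1 = g (F.proj z) • (form j).toFun z.1

namespace CodimOneDistribution

variable {n : ℕ} {F : DiagonalContraction n} (D : CodimOneDistribution F)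

/-- The distribution is integrable: its local forms satisfy `ωᵢ ∧ dωᵢ = 0`. -/
def IsIntegrable : Prop :=
  ∀ i, IsIntegrableOn (D.form i).toFun (F.lift (D.U i))

/-- The distribution is induced by the holomorphic `1`-form `ω` on `W`: `ω` generates the
pull-back of the distribution to `W`, i.e. on each `π⁻¹(Uᵢ)` it is the product of `π^* ωᵢ` and a
nowhere vanishing holomorphic function. -/
def IsInducedBy (ω : (Fin n → ℂ) → ((Fin n → ℂ) →L[ℂ] ℂ)) : Prop :=
  DifferentiableOn ℂ ω {z | z ≠ 0} ∧
  ∀ i, ∃ g : (Fin n → ℂ) → ℂ, DifferentiableOn ℂ g (F.lift (D.U i)) ∧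
    ∀ z ∈ F.lift (D.U i), g z ≠ 0 ∧ ω z = g z • (D.form i).toFun z

end CodimOneDistribution

/-- The `1`-form `∑ᵢ cᵢ z₁^{m₁} ⋯ zᵢ^{mᵢ - 1} ⋯ zₙ^{mₙ} dzᵢ`. It is used only when `cᵢ = 0` for all
`i` with `mᵢ = 0`. -/
def monomialForm {n : ℕ} (c : Fin n → ℂ) (m : Fin n → ℕ) (z : Fin n → ℂ) : (Fin n → ℂ) →L[ℂ] ℂ :=
  ∑ i, (c i * (z i ^ (m i - 1) * ∏ j ∈ Finset.univ.erase i, z j ^ m j)) •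
    ContinuousLinearMap.proj (R := ℂ) (φ := fun _ : Fin n => ℂ) i

end Hopf

end

/-! Pull everything back to W = ℂⁿ ∖ {0}. The local forms differ by units on overlaps. So, for an
index l whose coefficient is not identically zero, the l-th coefficients are local equations of an
effective divisor on W, and this divisor is invariant under f.

The heart of the proof is `IsDivisor.eq_monomial`: under a generic contraction such a divisor is a
combination of coordinate hyperplanes, with equation z^α. Dividing each local form by the unit (l-th
coefficient)/z^α produces forms that agree on overlaps, hence one holomorphic form η on W. Its l-th
coefficient is z^α, so f^*η = μ^α μ_l η (`exists_global_form`). By Hartogs the coefficients of η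
extend to 0. The k-th one is an eigenfunction of f with eigenvalue μ^m / μ_k, where m = α + e_l, and
multiplicative independence of the μ_i leaves only the monomial z^{m - e_k}, or zero if m_k = 0
(`exists_monomial_of_eigen`). Thus η = z^m ∑ c_i dz_i/z_i, a function times a closed logarithmic
form, and ω ∧ dω = 0 for η and all its multiples.

Two steps carry the result on divisors. First, the divisor gets an equation h at the origin
(`IsDivisor.exists_extension`). Write ℂⁿ = E × ℂ with the ℂ-axis not inside the divisor. Over each y
≠ 0 in E near 0, the divisor in a fixed disc has a unique normalised Weierstrass equation. These
equations glue by uniqueness and extend across the axis by Hartogs, since the axis has codimension n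
- 1 ≥ 2.

Second, invariance gives h ∘ f = U h with U holomorphic at 0. Write h = z^α q with q not identically
zero on any hyperplane z_k = 0. Restricting q to that hyperplane shows that U(0)/μ^α is a monomial
in the μ_i with i ≠ k (`multiplier_of_coordProj`). By independence it is the same monomial for every
k, hence trivial, and then q(0) ≠ 0 (`exists_eq_monomial_mul_unit`). This describes the divisor near
0, and the contraction carries the description to all of W. -/

namespace Hopf

open Filter Metric Set

/-! ### Germs of holomorphic functions up to units -/

section Germs

set_option linter.unusedSectionVars false

variable {E F G : Type*} [NormedAddCommGroup E] [NormedSpace ℂ E]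
  [NormedAddCommGroup F] [NormedSpace ℂ F] [NormedAddCommGroup G] [NormedSpace ℂ G]

/-- `φ` is holomorphic in a neighbourhood of `p`. -/
def HolAt (φ : E → F) (p : E) : Prop := ∀ᶠ z in 𝓝 p, DifferentiableAt ℂ φ z

theorem HolAt.differentiableAt {φ : E → F} {p : E} (h : HolAt φ p) : DifferentiableAt ℂ φ p :=
  h.self_of_nhds

theorem HolAt.continuousAt {φ : E → F} {p : E} (h : HolAt φ p) : ContinuousAt φ p :=
  h.differentiableAt.continuousAt

theorem HolAt.eventually {φ : E → F} {p : E} (h : HolAt φ p) : ∀ᶠ z in 𝓝 p, HolAt φ z :=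
  eventually_eventually_nhds.2 h

theorem HolAt.congr {φ ψ : E → F} {p : E} (h : HolAt φ p) (he : φ =ᶠ[𝓝 p] ψ) : HolAt ψ p := by
  filter_upwards [h, he.eventuallyEq_nhds] with z hz hz'
  exact hz.congr_of_eventuallyEq hz'.symm

theorem holAt_const (c : F) (p : E) : HolAt (fun _ => c) p :=
  Eventually.of_forall fun _ => differentiableAt_const c

theorem HolAt.of_differentiableOn {φ : E → F} {S : Set E} {p : E} (h : DifferentiableOn ℂ φ S)
    (hS : S ∈ 𝓝 p) : HolAt φ p := by
  filter_upwards [eventually_mem_nhds_iff.2 hS] with z hz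
  exact h.differentiableAt hz

theorem _root_.Differentiable.holAt {φ : E → F} (h : Differentiable ℂ φ) (p : E) : HolAt φ p :=
  Eventually.of_forall fun z => h z

theorem HolAt.mul {φ ψ : E → ℂ} {p : E} (h : HolAt φ p) (h' : HolAt ψ p) :
    HolAt (fun z => φ z * ψ z) p := by
  filter_upwards [h, h'] with z hz hz'
  exact hz.mul hz'

theorem HolAt.inv {φ : E → ℂ} {p : E} (h : HolAt φ p) (h0 : φ p ≠ 0) :
    HolAt (fun z => (φ z)⁻¹) p := by
  filter_upwards [h, h.continuousAt.eventually_ne h0] with z hz hz'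
  exact hz.inv hz'

theorem HolAt.comp {φ : F → G} {ψ : E → F} {p : E} (h : HolAt φ (ψ p)) (h' : HolAt ψ p) :
    HolAt (fun z => φ (ψ z)) p := by
  filter_upwards [h', h'.continuousAt.eventually h] with z hz hz'
  exact hz'.comp z hz

theorem HolAt.comp_clm {φ : F → G} (A : E →L[ℂ] F) {p : E} (h : HolAt φ (A p)) :
    HolAt (fun z => φ (A z)) p :=
  HolAt.comp h (A.differentiable.holAt p)

theorem holAt_finset_prod {ι : Type*} (s : Finset ι) {φ : ι → E → ℂ} {p : E}
    (h : ∀ i ∈ s, HolAt (φ i) p) : HolAt (fun z => ∏ i ∈ s, φ i z) p := by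
  classical
  induction s using Finset.induction_on with
  | empty => simpa using holAt_const (1 : ℂ) p
  | insert a s ha ih =>
    simp only [Finset.prod_insert ha]
    exact (h a (by simp)).mul (ih fun i hi => h i (by simp [hi]))

/-- The identity theorem on a convex open set. -/
theorem eq_zero_of_eventuallyEq_zero_of_convex {φ : E → ℂ} {S : Set E} (hS : IsOpen S)
    (hc : Convex ℝ S) (hφ : DifferentiableOn ℂ φ S) {p : E} (hp : p ∈ S)
    (h0 : φ =ᶠ[𝓝 p] 0) : ∀ z ∈ S, φ z = 0 := by
  intro z hz
  -- Restriction to the complex line through p and z reduces to the one-variable identity theorem;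
  -- convexity of S makes the slice T connected.
  let A : ℂ → E := fun t => p + t • (z - p)
  have hA : Differentiable ℂ A := by fun_prop
  let T : Set ℂ := A ⁻¹' S
  have hT : IsOpen T := hS.preimage hA.continuous
  have hTc : Convex ℝ T := by
    intro s hs t ht a b ha hb hab
    have := hc hs ht ha hb hab
    change A _ ∈ S
    convert this using 1
    simp only [A, smul_add, add_smul, smul_sub]
    have e : ∀ (r : ℝ) (w : ℂ) (x : E), (r • w) • x = r • (w • x) := fun r w x => smul_assoc r w x
    rw [e, e, e, e]
    have : p = a • p + b • p := by rw [← add_smul, hab, one_smul]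
    nth_rewrite 1 [this]
    abel
  have hd : DifferentiableOn ℂ (fun t => φ (A t)) T :=
    hφ.comp hA.differentiableOn (fun t ht => ht)
  have h0T : (0 : ℂ) ∈ T := by simpa [T, A] using hp
  have h1T : (1 : ℂ) ∈ T := by simpa [T, A] using hz
  have hev : (fun t => φ (A t)) =ᶠ[𝓝 0] 0 := by
    have : Tendsto A (𝓝 0) (𝓝 p) := by
      have := hA.continuous.tendsto 0
      simpa [A] using this
    exact this.eventually h0
  have := (hd.analyticOnNhd hT).eqOn_zero_of_preconnected_of_eventuallyEq_zero
    hTc.isPreconnected h0T hev h1T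
  simpa [A] using this

/-- The germ of `φ` at `p` is not zero. -/
def NonzeroGerm (φ : E → ℂ) (p : E) : Prop := ∃ᶠ z in 𝓝 p, φ z ≠ 0

/-- On a ball around p where φ is holomorphic, vanishing near one point forces vanishing on the
whole ball, by the identity theorem. -/
theorem NonzeroGerm.eventually {φ : E → ℂ} {p : E} (h : NonzeroGerm φ p) (hφ : HolAt φ p) :
    ∀ᶠ z in 𝓝 p, NonzeroGerm φ z := by
  obtain ⟨r, hr, hd⟩ := Metric.eventually_nhds_iff_ball.1 hφ
  filter_upwards [ball_mem_nhds p hr] with z hz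
  intro hcon
  refine h ?_
  simp only [ne_eq, not_not] at hcon
  have := eq_zero_of_eventuallyEq_zero_of_convex isOpen_ball (convex_ball p r)
      (fun w hw => (hd w hw).differentiableWithinAt) hz hcon
  filter_upwards [ball_mem_nhds p hr] with w hw
  simpa using this w hw

theorem NonzeroGerm.of_ne {φ : E → ℂ} {p : E} (h : φ p ≠ 0) (hφ : ContinuousAt φ p) :
    NonzeroGerm φ p := (hφ.eventually_ne h).frequently

/-- Arbitrarily close to p there are points z with ψ z ≠ 0. Near such a z the factor ψ stays
nonzero, while φ still has a nonzero germ at z. -/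
theorem NonzeroGerm.mul {φ ψ : E → ℂ} {p : E} (h : NonzeroGerm φ p) (hφ : HolAt φ p)
    (h' : NonzeroGerm ψ p) (hψ : HolAt ψ p) : NonzeroGerm (fun z => φ z * ψ z) p := by
  have h1 : ∃ᶠ z in 𝓝 p, ψ z ≠ 0 := h'
  refine frequently_frequently_nhds.1
    (((h1.and_eventually (h.eventually hφ)).and_eventually hψ).mono ?_)
  rintro z ⟨⟨h1, h2⟩, h3⟩
  exact (Frequently.and_eventually h2 (h3.continuousAt.eventually_ne h1)).mono
    fun w hw => mul_ne_zero hw.1 hw.2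

theorem NonzeroGerm.congr {φ ψ : E → ℂ} {p : E} (h : NonzeroGerm φ p) (he : φ =ᶠ[𝓝 p] ψ) :
    NonzeroGerm ψ p :=
  (Frequently.and_eventually h he).mono fun z hz => by rw [← hz.2]; exact hz.1

/-- Cancellation of a nonzero germ. -/
theorem NonzeroGerm.cancel {φ g g' : E → ℂ} {p : E} (h : NonzeroGerm φ p)
    (hg : ContinuousAt g p) (hg' : ContinuousAt g' p)
    (he : ∀ᶠ z in 𝓝 p, g z * φ z = g' z * φ z) : g p = g' p := by
  by_contra hne
  have := (hg.sub hg').eventually_ne (sub_ne_zero.2 hne)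
  obtain ⟨z, h1, h2, h3⟩ := (Frequently.and_eventually h (he.and this)).exists
  exact h3 (sub_eq_zero.2 (mul_right_cancel₀ h1 h2))

/-- The germs of `φ` and `ψ` at `p` differ by a unit. -/
def Assoc (φ ψ : E → ℂ) (p : E) : Prop :=
  ∃ g : E → ℂ, HolAt g p ∧ g p ≠ 0 ∧ ∀ᶠ z in 𝓝 p, φ z = g z * ψ z

theorem Assoc.of_eventuallyEq {φ ψ : E → ℂ} {p : E} (h : φ =ᶠ[𝓝 p] ψ) : Assoc φ ψ p :=
  ⟨fun _ => 1, holAt_const 1 p, one_ne_zero, h.mono fun z hz => by simp [hz]⟩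

theorem Assoc.symm {φ ψ : E → ℂ} {p : E} (h : Assoc φ ψ p) : Assoc ψ φ p := by
  obtain ⟨g, hg, hg0, he⟩ := h
  refine ⟨fun z => (g z)⁻¹, hg.inv hg0, inv_ne_zero hg0, ?_⟩
  filter_upwards [he, hg.continuousAt.eventually_ne hg0] with z hz hz'
  rw [hz, inv_mul_cancel_left₀ hz']

theorem Assoc.trans {φ ψ χ : E → ℂ} {p : E} (h : Assoc φ ψ p) (h' : Assoc ψ χ p) :
    Assoc φ χ p := by
  obtain ⟨g, hg, hg0, he⟩ := h
  obtain ⟨g', hg', hg0', he'⟩ := h'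
  refine ⟨fun z => g z * g' z, hg.mul hg', mul_ne_zero hg0 hg0', ?_⟩
  filter_upwards [he, he'] with z hz hz'
  rw [hz, hz', mul_assoc]

theorem Assoc.mul {φ ψ φ' ψ' : E → ℂ} {p : E} (h : Assoc φ ψ p) (h' : Assoc φ' ψ' p) :
    Assoc (fun z => φ z * φ' z) (fun z => ψ z * ψ' z) p := by
  obtain ⟨g, hg, hg0, he⟩ := h
  obtain ⟨g', hg', hg0', he'⟩ := h'
  refine ⟨fun z => g z * g' z, hg.mul hg', mul_ne_zero hg0 hg0', ?_⟩
  filter_upwards [he, he'] with z hz hz'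
  rw [hz, hz']; ring

theorem Assoc.of_ne {φ : E → ℂ} {p : E} (h : HolAt φ p) (h0 : φ p ≠ 0) :
    Assoc φ (fun _ => 1) p := ⟨φ, h, h0, Eventually.of_forall fun z => by simp⟩

theorem Assoc.eventually {φ ψ : E → ℂ} {p : E} (h : Assoc φ ψ p) :
    ∀ᶠ z in 𝓝 p, Assoc φ ψ z := by
  obtain ⟨g, hg, hg0, he⟩ := h
  filter_upwards [hg.eventually, hg.continuousAt.eventually_ne hg0,
    eventually_eventually_nhds.2 he] with z h1 h2 h3
  exact ⟨g, h1, h2, h3⟩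

theorem Assoc.comp {φ ψ : F → ℂ} {A : E → F} {p : E} (h : Assoc φ ψ (A p)) (hA : HolAt A p) :
    Assoc (fun z => φ (A z)) (fun z => ψ (A z)) p := by
  obtain ⟨g, hg, hg0, he⟩ := h
  exact ⟨fun z => g (A z), hg.comp hA, hg0, hA.continuousAt.eventually he⟩

theorem Assoc.nonzeroGerm {φ ψ : E → ℂ} {p : E} (h : Assoc φ ψ p) (hψ : NonzeroGerm ψ p) :
    NonzeroGerm φ p := by
  obtain ⟨g, hg, hg0, he⟩ := h
  refine (Frequently.and_eventually hψ (he.and (hg.continuousAt.eventually_ne hg0))).mono ?_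
  rintro z ⟨h1, h2, h3⟩
  rw [h2]; exact mul_ne_zero h3 h1

theorem Assoc.holAt {φ ψ : E → ℂ} {p : E} (h : Assoc φ ψ p) (hψ : HolAt ψ p) : HolAt φ p := by
  obtain ⟨g, hg, hg0, he⟩ := h
  exact (hg.mul hψ).congr (he.mono fun z hz => hz.symm)

theorem Assoc.eq_zero_iff {φ ψ : E → ℂ} {p : E} (h : Assoc φ ψ p) : φ p = 0 ↔ ψ p = 0 := by
  obtain ⟨g, hg, hg0, he⟩ := h
  rw [he.self_of_nhds]; simp [hg0]

/-- Locally defined units that relate two functions glue. -/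
theorem exists_unit_of_assoc {φ ψ : E → ℂ} {S : Set E} (hS : IsOpen S)
    (h : ∀ p ∈ S, Assoc φ ψ p) (h0 : ∀ p ∈ S, NonzeroGerm ψ p) :
    ∃ g : E → ℂ, (∀ p ∈ S, HolAt g p) ∧ ∀ p ∈ S, g p ≠ 0 ∧ φ p = g p * ψ p := by
  classical
  choose! g hg hg0 he using h
  -- As ψ has no zero germ, the unit is determined by φ and ψ. The local choices therefore agree,
  -- and the diagonal q ↦ g q q is holomorphic.
  have key : ∀ p ∈ S, (fun q => g q q) =ᶠ[𝓝 p] g p := by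
    intro p hp
    filter_upwards [hS.mem_nhds hp, (hg p hp).eventually, eventually_eventually_nhds.2 (he p hp)]
      with q hq h1 h2
    refine (h0 q hq).cancel (hg q hq).continuousAt h1.continuousAt ?_
    filter_upwards [he q hq, h2] with z hz hz'
    rw [← hz, hz']
  exact ⟨fun q => g q q, fun p hp => (hg p hp).congr (key p hp).symm,
    fun p hp => ⟨hg0 p hp, (he p hp).self_of_nhds⟩⟩

end Germs

/-! ### Circle integrals with parameters and Cauchy's formula on an annulus -/

section CircleIntegral

variable {E : Type*} [NormedAddCommGroup E] [NormedSpace ℂ E] [FiniteDimensional ℂ E]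

/-- The derivative of a holomorphic function depends continuously on a parameter. -/
theorem continuousOn_fderiv_param {S : Set E} (hS : IsOpen S) {T : Set ℂ} (hT : IsCompact T)
    {G : E × ℂ → ℂ} (hG : ContinuousOn G (S ×ˢ T))
    (hd : ∀ ζ ∈ T, DifferentiableOn ℂ (fun y => G (y, ζ)) S) {y₀ : E} (hy : y₀ ∈ S) :
    ContinuousOn (fun ζ => fderiv ℂ (fun y => G (y, ζ)) y₀) T := by
  have : ProperSpace E := FiniteDimensional.proper ℂ E
  obtain ⟨ρ, hρ, hρS⟩ := Metric.nhds_basis_closedBall.mem_iff.1 (hS.mem_nhds hy)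
  have hK : IsCompact (closedBall y₀ ρ ×ˢ T) := (isCompact_closedBall y₀ ρ).prod hT
  have hu : UniformContinuousOn G (closedBall y₀ ρ ×ˢ T) :=
    hK.uniformContinuousOn_of_continuous (hG.mono (prod_mono hρS le_rfl))
  rw [Metric.uniformContinuousOn_iff] at hu
  intro ζ₀ hζ₀
  rw [Metric.continuousWithinAt_iff]
  intro ε hε
  obtain ⟨η, hη, hu⟩ := hu (ε * ρ / 4) (by positivity)
  refine ⟨η, hη, fun {ζ} hζ hdist => ?_⟩
  have hsub : ∀ ξ ∈ T, DifferentiableOn ℂ (fun y => G (y, ξ)) (ball y₀ ρ) := fun ξ hξ =>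
    (hd ξ hξ).mono (ball_subset_closedBall.trans hρS)
  have hat : ∀ ξ ∈ T, DifferentiableAt ℂ (fun y => G (y, ξ)) y₀ := fun ξ hξ =>
    (hsub ξ hξ).differentiableAt (ball_mem_nhds _ hρ)
  have hclose : ∀ y ∈ closedBall y₀ ρ, ‖G (y, ζ) - G (y, ζ₀)‖ < ε * ρ / 4 := by
    intro y hy
    rw [← dist_eq_norm]
    refine hu (y, ζ) ⟨hy, hζ⟩ (y, ζ₀) ⟨hy, hζ₀⟩ ?_
    simpa [Prod.dist_eq] using hdist
  -- Cauchy's estimate for the difference of two slices. That difference is below ε ρ / 4 on the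
  -- ball by uniform continuity, so it moves by at most twice that from its value at the centre.
  have hb := Complex.norm_fderiv_le_div_of_mapsTo_ball (R₁ := ρ) (R₂ := ε * ρ / 2)
    (f := fun y => G (y, ζ) - G (y, ζ₀)) (c := y₀) ((hsub ζ hζ).sub (hsub ζ₀ hζ₀)) (by
      intro y hy
      rw [mem_closedBall, dist_eq_norm]
      have h1 := hclose y (ball_subset_closedBall hy)
      have h2 := hclose y₀ (mem_closedBall_self hρ.le)
      refine (norm_sub_le _ _).trans ?_
      linarith) hρ
  rw [dist_eq_norm, ← fderiv_fun_sub (hat ζ hζ) (hat ζ₀ hζ₀)]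
  refine hb.trans_lt ?_
  have : ε * ρ / 2 / ρ = ε / 2 := by field_simp
  rw [this]; linarith

/-- A circle integral depends holomorphically on the parameters. -/
theorem differentiableOn_circleIntegral {S : Set E} (hS : IsOpen S) {c : ℂ} {r : ℝ}
    (hr : 0 ≤ r) {G : E × ℂ → ℂ} (hG : ContinuousOn G (S ×ˢ sphere c r))
    (hd : ∀ ζ ∈ sphere c r, DifferentiableOn ℂ (fun y => G (y, ζ)) S) :
    DifferentiableOn ℂ (fun y => ∮ ζ in C(c, r), G (y, ζ)) S := by
  have : ProperSpace E := FiniteDimensional.proper ℂ E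
  intro y₀ hy₀
  refine DifferentiableAt.differentiableWithinAt ?_
  obtain ⟨ρ, hρ, hρS⟩ := Metric.nhds_basis_closedBall.mem_iff.1 (hS.mem_nhds hy₀)
  have hK : IsCompact (closedBall y₀ ρ ×ˢ sphere c r) :=
    (isCompact_closedBall y₀ ρ).prod (isCompact_sphere c r)
  obtain ⟨M, hM⟩ := hK.exists_bound_of_continuousOn (hG.mono (prod_mono hρS le_rfl))
  have hmem : ∀ θ : ℝ, circleMap c r θ ∈ sphere c r := circleMap_mem_sphere c hr
  have hsl : ∀ y ∈ S, Continuous fun θ : ℝ => deriv (circleMap c r) θ • G (y, circleMap c r θ) := by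
    intro y hy
    have : Continuous fun θ : ℝ => G (y, circleMap c r θ) :=
      hG.comp_continuous (by fun_prop) fun θ => ⟨hy, hmem θ⟩
    have h2 : Continuous (deriv (circleMap c r)) := by
      simp only [funext (deriv_circleMap c r)]; fun_prop
    exact h2.smul this
  have hF' : Continuous fun θ : ℝ => deriv (circleMap c r) θ •
      fderiv ℂ (fun y => G (y, circleMap c r θ)) y₀ := by
    have := (continuousOn_fderiv_param hS (isCompact_sphere c r) hG hd hy₀).comp_continuous
      (continuous_circleMap c r) hmem
    have h2 : Continuous (deriv (circleMap c r)) := by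
      simp only [funext (deriv_circleMap c r)]; fun_prop
    exact h2.smul this
  -- Differentiation under the integral sign. The dominating constant is Cauchy's estimate on balls
  -- of radius ρ / 2, which stay inside the ball of radius ρ where |G| ≤ M.
  have := intervalIntegral.hasFDerivAt_integral_of_dominated_of_fderiv_le
    (𝕜 := ℂ) (μ := MeasureTheory.volume) (a := 0) (b := 2 * Real.pi)
    (F := fun y θ => deriv (circleMap c r) θ • G (y, circleMap c r θ))
    (F' := fun y θ => deriv (circleMap c r) θ • fderiv ℂ (fun y => G (y, circleMap c r θ)) y)
    (x₀ := y₀) (s := ball y₀ (ρ / 2)) (bound := fun _ => r * (2 * M / (ρ / 2)))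
    (ball_mem_nhds _ (by positivity))
    (by
      filter_upwards [hS.mem_nhds hy₀] with y hy
      exact (hsl y hy).aestronglyMeasurable)
    ((hsl y₀ hy₀).intervalIntegrable _ _)
    hF'.aestronglyMeasurable
    (Eventually.of_forall fun θ _ y hy => by
      rw [norm_smul, deriv_circleMap]
      have h1 : ‖circleMap 0 r θ * Complex.I‖ = r := by simp [abs_of_nonneg hr]
      rw [h1]
      have hsub : ball y (ρ / 2) ⊆ closedBall y₀ ρ := by
        intro x hx
        rw [mem_ball] at hx hy
        rw [mem_closedBall]
        linarith [dist_triangle x y y₀]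
      refine mul_le_mul_of_nonneg_left ?_ hr
      refine Complex.norm_fderiv_le_div_of_mapsTo_ball (R₁ := ρ / 2)
        (((hd _ (hmem θ)).mono hρS).mono hsub) ?_ (by positivity)
      intro x hx
      rw [mem_closedBall, dist_eq_norm]
      have a1 := hM (x, circleMap c r θ) ⟨hsub hx, hmem θ⟩
      have a2 := hM (y, circleMap c r θ) ⟨hsub (mem_ball_self (by positivity)), hmem θ⟩
      refine (norm_sub_le _ _).trans ?_
      linarith)
    (by simp)
    (Eventually.of_forall fun θ _ y hy => by
      have hyS : y ∈ S := hρS (ball_subset_closedBall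
        (ball_subset_ball (by linarith) hy))
      exact (((hd _ (hmem θ)).differentiableAt (hS.mem_nhds hyS)).hasFDerivAt).const_smul
        (deriv (circleMap c r) θ))
  exact this.differentiableAt

/-- Cauchy's formula for a function on an annulus. -/
theorem two_pi_I_mul_eq_sub_of_annulus {f : ℂ → ℂ} {c t : ℂ} {r₁ r₂ : ℝ} (h₁ : 0 < r₁)
    (hf : ∀ z, r₁ ≤ dist z c → dist z c ≤ r₂ → DifferentiableAt ℂ f z)
    (ht₁ : r₁ < dist t c) (ht₂ : dist t c < r₂) :
    2 * Real.pi * Complex.I * f t =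
      (∮ ζ in C(c, r₂), f ζ / (ζ - t)) - ∮ ζ in C(c, r₁), f ζ / (ζ - t) := by
  have hne : ∀ r : ℝ, dist t c ≠ r → ∀ ζ ∈ sphere c r, ζ - t ≠ 0 := by
    intro r hr ζ hζ h0
    rw [sub_eq_zero.1 h0] at hζ
    exact hr hζ
  have hcont : ∀ z ∈ closedBall c r₂ \ ball c r₁, DifferentiableAt ℂ f z := by
    rintro z ⟨hz1, hz2⟩
    exact hf z (by simpa using hz2) hz1
  have htn : closedBall c r₂ \ ball c r₁ ∈ 𝓝 t := by
    refine Filter.mem_of_superset ((isOpen_ball.sdiff isClosed_closedBall).mem_nhds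
      (⟨ht₂, by simpa using ht₁⟩ : t ∈ ball c r₂ \ closedBall c r₁)) ?_
    exact sdiff_subset_sdiff ball_subset_closedBall ball_subset_closedBall
  -- The difference quotient of f at t has a removable singularity there, so its integrals over the
  -- two circles agree. What remains is the integral of 1/(ζ - t), which is 2πi over the outer
  -- circle and 0 over the inner one.
  have key := Complex.circleIntegral_eq_of_differentiable_on_annulus_off_countable
    (f := dslope f t) h₁ (ht₁.trans ht₂).le (s := {t}) (countable_singleton t)
    ((continuousOn_dslope htn).2 ⟨fun z hz => (hcont z hz).continuousAt.continuousWithinAt,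
      hcont t (mem_of_mem_nhds htn)⟩) (by
      rintro z ⟨⟨hz1, hz2⟩, hzt⟩
      rw [differentiableAt_dslope_of_ne hzt]
      exact hf z (by simpa using (not_le.1 hz2).le) (le_of_lt hz1))
  have hr₂ : 0 < r₂ := h₁.trans (ht₁.trans ht₂)
  have split : ∀ r : ℝ, r₁ ≤ r → r ≤ r₂ → dist t c ≠ r →
      ∮ ζ in C(c, r), dslope f t ζ =
        (∮ ζ in C(c, r), f ζ / (ζ - t)) - f t * ∮ ζ in C(c, r), (ζ - t)⁻¹ := by
    intro r hr hr' hd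
    have hr0 : 0 < r := h₁.trans_le hr
    have c1 : ContinuousOn (fun ζ => f ζ / (ζ - t)) (sphere c r) := by
      intro ζ hζ
      have : dist ζ c = r := hζ
      exact ((hf ζ (by rw [this]; exact hr) (by rw [this]; exact hr')).continuousAt.div
        (by fun_prop) (hne r hd ζ hζ)).continuousWithinAt
    have c2 : ContinuousOn (fun ζ => f t * (ζ - t)⁻¹) (sphere c r) := by
      intro ζ hζ
      have : ContinuousAt (fun ζ => ζ - t) ζ := by fun_prop
      exact ((this.inv₀ (hne r hd ζ hζ)).const_mul (f t)).continuousWithinAt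
    rw [← circleIntegral.integral_const_mul, ← circleIntegral.integral_sub
      (c1.circleIntegrable hr0.le) (c2.circleIntegrable hr0.le)]
    refine circleIntegral.integral_congr hr0.le fun ζ hζ => ?_
    have h0 := hne r hd ζ hζ
    rw [dslope_of_ne f (sub_ne_zero.1 h0), slope_def_field]
    field_simp
  rw [split r₂ (ht₁.trans ht₂).le le_rfl ht₂.ne, split r₁ le_rfl (ht₁.trans ht₂).le ht₁.ne',
    circleIntegral.integral_sub_inv_of_mem_ball ht₂,
    Complex.circleIntegral_eq_zero_of_differentiable_on_off_countable h₁.le countable_empty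
      (f := fun ζ => (ζ - t)⁻¹) ?_ ?_] at key
  · linear_combination -key
  · intro ζ hζ
    have : ζ - t ≠ 0 := by
      intro h0
      rw [sub_eq_zero.1 h0] at hζ
      exact absurd (mem_closedBall.1 hζ) (not_le.2 ht₁)
    have h' : ContinuousAt (fun ζ => ζ - t) ζ := by fun_prop
    exact (h'.inv₀ this).continuousWithinAt
  · rintro ζ ⟨hζ, -⟩
    have : ζ - t ≠ 0 := by
      intro h0
      rw [sub_eq_zero.1 h0] at hζ
      exact absurd (mem_ball.1 hζ) (not_lt.2 ht₁.le)
    have h' : DifferentiableAt ℂ (fun ζ => ζ - t) ζ := by fun_prop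
    exact h'.inv this

end CircleIntegral

/-! ### Hartogs extension in codimension two -/

section Hartogs

variable {X : Type*} [NormedAddCommGroup X] [NormedSpace ℂ X]

theorem nonzeroGerm_clm (β : X →L[ℂ] ℂ) {w : X} (hw : β w ≠ 0) (x : X) : NonzeroGerm β x := by
  intro h
  simp only [ne_eq, not_not] at h
  exact hw (eq_zero_of_eventuallyEq_zero_of_convex isOpen_univ convex_univ
    β.differentiable.differentiableOn (mem_univ x) h w (mem_univ w))

variable [FiniteDimensional ℂ X]

/-- Hartogs' extension theorem across a subset `N` of a linear subspace of codimension two. -/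
theorem hartogs (α β : X →L[ℂ] ℂ) {v w : X} (hv : α v = 1) (hβv : β v = 0) (hw : β w ≠ 0)
    {N : Set X} (hN : ∀ x ∈ N, α x = 0 ∧ β x = 0) {p : X} (hp : α p = 0) {φ : X → ℂ}
    (hφ : ∀ᶠ x in 𝓝 p, x ∉ N → DifferentiableAt ℂ φ x) :
    ∃ Φ : X → ℂ, HolAt Φ p ∧ ∀ᶠ x in 𝓝 p, x ∉ N → Φ x = φ x := by
  let A : X × ℂ → X := fun q => q.1 - α q.1 • v + q.2 • v
  have hA : Differentiable ℂ A := by fun_prop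
  have hαA : ∀ x ζ, α (A (x, ζ)) = ζ := by intro x ζ; simp [A, hv]
  have hβA : ∀ x ζ, β (A (x, ζ)) = β x := by intro x ζ; simp [A, hβv]
  have hAα : ∀ x, A (x, α x) = x := by intro x; simp [A]
  have hA0 : A (p, 0) = p := by simp [A, hp]
  have hev : ∀ᶠ q in 𝓝 (p, (0 : ℂ)), A q ∉ N → DifferentiableAt ℂ φ (A q) := by
    have : Tendsto A (𝓝 (p, 0)) (𝓝 p) := by
      have := hA.continuous.tendsto (p, 0)
      rwa [hA0] at this
    exact this.eventually hφ
  obtain ⟨S₀, T, hS₀, hpS₀, hT, h0T, hST⟩ := mem_nhds_prod_iff'.1 hev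
  obtain ⟨r, hr, hrT⟩ := Metric.nhds_basis_closedBall.mem_iff.1 (hT.mem_nhds h0T)
  let S : Set X := S₀ ∩ {x | ‖α x‖ < r}
  have hS : IsOpen S := hS₀.inter (isOpen_lt (by fun_prop) continuous_const)
  have hpS : p ∈ S := ⟨hpS₀, by simpa [hp] using hr⟩
  have hdA : ∀ x ∈ S, ∀ ζ ∈ closedBall (0 : ℂ) r, ¬(ζ = 0 ∧ β x = 0) →
      DifferentiableAt ℂ φ (A (x, ζ)) := by
    intro x hx ζ hζ hne
    refine hST (show (x, ζ) ∈ S₀ ×ˢ T from ⟨hx.1, hrT hζ⟩) fun hmem => hne ?_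
    have := hN _ hmem
    rwa [hαA, hβA] at this
  -- Cauchy's integral along the line in direction v. The circle |ζ| = r avoids α = 0, hence N, so Φ
  -- is holomorphic even over points of N.
  let Φ : X → ℂ := fun x =>
    (2 * Real.pi * Complex.I)⁻¹ * ∮ ζ in C(0, r), (ζ - α x)⁻¹ * φ (A (x, ζ))
  have hsphere : ∀ ζ ∈ sphere (0 : ℂ) r, ζ ≠ 0 := by
    rintro ζ hζ rfl
    exact hr.ne (by simpa using hζ)
  have hkernel : ∀ x ∈ S, ∀ ζ ∈ sphere (0 : ℂ) r, ζ - α x ≠ 0 := by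
    intro x hx ζ hζ h0
    have h1 : ‖ζ‖ = r := by simpa using hζ
    rw [sub_eq_zero.1 h0] at h1
    exact absurd hx.2 (by simp [h1])
  have hΦ : DifferentiableOn ℂ Φ S := by
    refine (differentiableOn_circleIntegral hS hr.le
      (G := fun q => (q.2 - α q.1)⁻¹ * φ (A q)) ?_ ?_).const_mul _
    · rintro ⟨x, ζ⟩ ⟨hx, hζ⟩
      have h1 : DifferentiableAt ℂ (fun q : X × ℂ => q.2 - α q.1) (x, ζ) := by fun_prop
      have h2 := (hdA x hx ζ (sphere_subset_closedBall hζ) fun h => hsphere ζ hζ h.1).comp (x, ζ)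
        (hA (x, ζ))
      exact ((h1.inv (hkernel x hx ζ hζ)).mul h2).continuousAt.continuousWithinAt
    · intro ζ hζ x hx
      have h1 : DifferentiableAt ℂ (fun x : X => ζ - α x) x := by fun_prop
      have h3 : DifferentiableAt ℂ (fun x => A (x, ζ)) x := by fun_prop
      have h2 := (hdA x hx ζ (sphere_subset_closedBall hζ) fun h => hsphere ζ hζ h.1).comp x h3
      exact ((h1.inv (hkernel x hx ζ hζ)).mul h2).differentiableWithinAt
  -- If β x ≠ 0, the entire disc in direction v misses N, and Cauchy's formula applies to φ itself.
  have heq : ∀ x ∈ S, β x ≠ 0 → Φ x = φ x := by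
    intro x hx hβ
    have hd : DifferentiableOn ℂ (fun ζ => φ (A (x, ζ))) (closedBall 0 r) := by
      intro ζ hζ
      have h3 : DifferentiableAt ℂ (fun ζ => A (x, ζ)) ζ := by fun_prop
      exact ((hdA x hx ζ hζ fun h => hβ h.2).comp ζ h3).differentiableWithinAt
    have := hd.circleIntegral_sub_inv_smul (w := α x) (by simpa using hx.2)
    simp only [smul_eq_mul, hAα] at this
    simp only [Φ, this]
    rw [inv_mul_cancel_left₀ Complex.two_pi_I_ne_zero]
  refine ⟨Φ, HolAt.of_differentiableOn hΦ (hS.mem_nhds hpS), ?_⟩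
  filter_upwards [hS.mem_nhds hpS, hφ] with x hx hd hxN
  refine (nonzeroGerm_clm β hw x).cancel (hΦ.differentiableAt (hS.mem_nhds hx)).continuousAt
    (hd hxN).continuousAt ?_
  filter_upwards [hS.mem_nhds hx] with z hz
  by_cases h0 : β z = 0
  · simp [h0]
  · rw [heq z hz h0]

/-- Two functions that differ by units off a set of codimension two differ by a unit. -/
theorem hartogs_assoc (α β : X →L[ℂ] ℂ) {v w : X} (hv : α v = 1) (hβv : β v = 0) (hw : β w ≠ 0)
    {N : Set X} (hNc : IsClosed N) (hN : ∀ x ∈ N, α x = 0 ∧ β x = 0) {p : X} (hp : α p = 0)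
    {φ ψ : X → ℂ} (hφ : HolAt φ p) (hψ : HolAt ψ p) (hψ0 : NonzeroGerm ψ p)
    (h : ∀ᶠ x in 𝓝 p, x ∉ N → Assoc φ ψ x) : Assoc φ ψ p := by
  obtain ⟨S, hSsub, hS, hpS⟩ := _root_.eventually_nhds_iff.1 (h.and (hψ0.eventually hψ))
  obtain ⟨g, hg, hg'⟩ := exists_unit_of_assoc (hS.sdiff hNc)
    (fun x hx => (hSsub x hx.1).1 hx.2) (fun x hx => (hSsub x hx.1).2)
  have hSp := hS.mem_nhds hpS
  obtain ⟨Φ, hΦ, hΦe⟩ := hartogs α β hv hβv hw hN hp (φ := g) (by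
    filter_upwards [hSp] with x hx hxN using (hg x ⟨hx, hxN⟩).differentiableAt)
  obtain ⟨Ψ, hΨ, hΨe⟩ := hartogs α β hv hβv hw hN hp (φ := fun x => (g x)⁻¹) (by
    filter_upwards [hSp] with x hx hxN using
      (hg x ⟨hx, hxN⟩).differentiableAt.inv (hg' x ⟨hx, hxN⟩).1)
  have hβ := nonzeroGerm_clm β hw
  -- The unit and its inverse both extend; the product of the extensions is 1 where β ≠ 0, hence at
  -- p by continuity. So the extension is again a unit.
  have hone : Φ p * Ψ p = 1 := by
    refine (hβ p).cancel (g := fun x => Φ x * Ψ x) (g' := fun _ => 1)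
      (hΦ.continuousAt.mul hΨ.continuousAt) continuousAt_const ?_
    filter_upwards [hSp, hΦe, hΨe] with x hx h1 h2
    by_cases h0 : β x = 0
    · simp [h0]
    · have hxN : x ∉ N := fun hh => h0 (hN x hh).2
      rw [h1 hxN, h2 hxN, mul_inv_cancel₀ (hg' x ⟨hx, hxN⟩).1]
  refine ⟨Φ, hΦ, left_ne_zero_of_mul_eq_one hone, ?_⟩
  have hoff : ∀ᶠ x in 𝓝 p, x ∉ N → φ x = Φ x * ψ x := by
    filter_upwards [hSp, hΦe] with x hx h1 hxN
    rw [h1 hxN, (hg' x ⟨hx, hxN⟩).2]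
  filter_upwards [hφ, hψ, hΦ, eventually_eventually_nhds.2 hoff] with x h1 h2 h3 h4
  refine (hβ x).cancel (g' := fun x => Φ x * ψ x) h1.continuousAt
    (h3.mul h2).continuousAt ?_
  filter_upwards [h4] with z hz
  by_cases h0 : β z = 0
  · simp [h0]
  · rw [hz fun hh => h0 (hN z hh).2]

/-- Hartogs' theorem for an isolated point of `ℂⁿ`, `n ≥ 2`. -/
theorem hartogs_point {n : ℕ} (hn : 2 ≤ n) {φ : (Fin n → ℂ) → ℂ}
    (hφ : ∀ᶠ x in 𝓝 (0 : Fin n → ℂ), x ≠ 0 → DifferentiableAt ℂ φ x) :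
    ∃ Φ : (Fin n → ℂ) → ℂ, HolAt Φ 0 ∧ ∀ᶠ x in 𝓝 0, x ≠ 0 → Φ x = φ x := by
  have h01 : (⟨0, by omega⟩ : Fin n) ≠ ⟨1, by omega⟩ := by simp
  exact hartogs (ContinuousLinearMap.proj (R := ℂ) (φ := fun _ : Fin n => ℂ) ⟨0, by omega⟩)
    (ContinuousLinearMap.proj (R := ℂ) (φ := fun _ : Fin n => ℂ) ⟨1, by omega⟩)
    (v := Pi.single ⟨0, by omega⟩ 1) (w := Pi.single ⟨1, by omega⟩ 1) (N := {0})
    (by simp) (by simp [h01.symm]) (by simp) (by simp) (by simp)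
    (by simpa using hφ)

end Hartogs

/-! ### Weierstrass preparation by a Laurent splitting of the logarithm -/

section Weierstrass

variable {E : Type*} [NormedAddCommGroup E] [NormedSpace ℂ E]

theorem _root_.DifferentiableAt.div_scalar {f g : E → ℂ} {p : E} (hf : DifferentiableAt ℂ f p)
    (hg : DifferentiableAt ℂ g p) (h0 : g p ≠ 0) : DifferentiableAt ℂ (fun z => f z / g z) p := by
  simp only [div_eq_mul_inv]
  exact hf.mul (hg.inv h0)

theorem differentiableOn_cauchyTransform [FiniteDimensional ℂ E] {S : Set E} (hS : IsOpen S)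
    {c : ℂ} {r : ℝ} (hr : 0 ≤ r) {Ψ : E × ℂ → ℂ}
    (hΨ : ∀ y ∈ S, ∀ ζ ∈ sphere c r, DifferentiableAt ℂ Ψ (y, ζ)) :
    DifferentiableOn ℂ (fun q : E × ℂ => ∮ ζ in C(c, r), Ψ (q.1, ζ) / (ζ - q.2))
      (S ×ˢ (sphere c r)ᶜ) := by
  have hne : ∀ q ∈ S ×ˢ (sphere c r)ᶜ, ∀ ζ ∈ sphere c r, ζ - q.2 ≠ 0 := by
    intro q hq ζ hζ h0
    exact hq.2 (by rwa [← sub_eq_zero.1 h0])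
  refine differentiableOn_circleIntegral (G := fun x : (E × ℂ) × ℂ =>
    Ψ (x.1.1, x.2) / (x.2 - x.1.2)) (hS.prod (isClosed_sphere.isOpen_compl)) hr ?_ ?_
  · rintro ⟨q, ζ⟩ ⟨hq, hζ⟩
    have h1 : DifferentiableAt ℂ (fun x : (E × ℂ) × ℂ => (x.1.1, x.2)) (q, ζ) := by fun_prop
    have h2 : DifferentiableAt ℂ (fun x : (E × ℂ) × ℂ => x.2 - x.1.2) (q, ζ) := by fun_prop
    exact (((hΨ q.1 hq.1 ζ hζ).comp (q, ζ) h1).div_scalar h2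
      (hne q hq ζ hζ)).continuousAt.continuousWithinAt
  · intro ζ hζ q hq
    have h1 : DifferentiableAt ℂ (fun x : E × ℂ => (x.1, ζ)) q := by fun_prop
    have h2 : DifferentiableAt ℂ (fun x : E × ℂ => ζ - x.2) q := by fun_prop
    exact (((hΨ q.1 hq.1 ζ hζ).comp q h1).div_scalar h2 (hne q hq ζ hζ)).differentiableWithinAt

/-- The kernel is at most 1/(|t| - |c| - r) on the circle. This decay normalises the outer Laurent
part, and with it the Weierstrass equation. -/
theorem tendsto_cauchyTransform {c : ℂ} {r : ℝ} (hr : 0 ≤ r) {f : ℂ → ℂ}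
    (hf : ContinuousOn f (sphere c r)) :
    Tendsto (fun t => ∮ ζ in C(c, r), f ζ / (ζ - t)) (cocompact ℂ) (𝓝 0) := by
  obtain ⟨C, hC⟩ := (isCompact_sphere c r).exists_bound_of_continuousOn hf
  have hlim : Tendsto (fun t : ℂ => ‖t‖ - (‖c‖ + r)) (cocompact ℂ) atTop :=
    tendsto_atTop_add_const_right _ _ (tendsto_norm_cocompact_atTop)
  have h2 : Tendsto (fun t : ℂ => 2 * Real.pi * r * (C / (‖t‖ - (‖c‖ + r)))) (cocompact ℂ)
      (𝓝 0) := by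
    simpa using (hlim.const_div_atTop C).const_mul (2 * Real.pi * r)
  refine squeeze_zero_norm' ?_ h2
  filter_upwards [hlim.eventually_gt_atTop 0] with t ht
  refine circleIntegral.norm_integral_le_of_norm_le_const hr fun ζ hζ => ?_
  rw [norm_div]
  have h3 : ‖t‖ - (‖c‖ + r) ≤ ‖ζ - t‖ := by
    have h4 : ‖ζ - c‖ = r := by simpa using hζ
    have h5 : ‖t‖ ≤ ‖ζ - t‖ + ‖ζ - c‖ + ‖c‖ := by
      calc ‖t‖ = ‖-(ζ - t) + (ζ - c) + c‖ := by ring_nf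
        _ ≤ _ := (norm_add_le _ _).trans (by gcongr; simpa [norm_sub_rev] using norm_add_le (-(ζ - t)) (ζ - c))
    linarith
  have hC0 : 0 ≤ C := (norm_nonneg _).trans (hC ζ hζ)
  gcongr
  exact hC ζ hζ

/-- The Weierstrass preparation theorem, with a normalisation at infinity that makes the
Weierstrass polynomial unique. -/
theorem exists_weierstrass [FiniteDimensional ℂ E] {b : E × ℂ → ℂ} {y₀ : E} {c : ℂ}
    (hb : HolAt b (y₀, c)) (h0 : ∃ᶠ t in 𝓝 c, b (y₀, t) ≠ 0) {V : Set ℂ} (hV : V ∈ 𝓝 c) :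
    ∃ ρ > 0, closedBall c ρ ⊆ V ∧ ∃ S : Set E, IsOpen S ∧ y₀ ∈ S ∧ ∃ P : E × ℂ → ℂ,
      DifferentiableOn ℂ P (S ×ˢ univ) ∧
      (∀ y ∈ S, ∀ t ∈ ball c ρ, Assoc P b (y, t)) ∧
      (∀ y ∈ S, ∀ t ∉ ball c ρ, P (y, t) ≠ 0) ∧
      ∃ N : ℕ, ∀ y ∈ S, Tendsto (fun t => P (y, t) / t ^ N) (cocompact ℂ) (𝓝 1) := by
  have hmk : Tendsto (fun t : ℂ => (y₀, t)) (𝓝 c) (𝓝 (y₀, c)) :=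
    (Continuous.prodMk_right y₀).tendsto c
  have hsl : HolAt (fun t => b (y₀, t)) c :=
    HolAt.comp (ψ := fun t : ℂ => (y₀, t)) hb
      (Differentiable.holAt (by fun_prop) c)
  have han : AnalyticAt ℂ (fun t => b (y₀, t)) c :=
    Complex.analyticAt_iff_eventually_differentiableAt.2 hsl
  obtain ⟨N, u, hu, hu0, hbu⟩ := han.exists_eventuallyEq_pow_smul_nonzero_iff.2 (by
    intro h; exact h0 (h.mono fun t ht => by simpa using ht))
  have huH : HolAt u c := Complex.analyticAt_iff_eventually_differentiableAt.1 hu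
  obtain ⟨R, hR, hRall⟩ := Metric.nhds_basis_closedBall.mem_iff.1
    (inter_mem (inter_mem (inter_mem hV (hmk.eventually hb.eventually))
      (inter_mem hbu huH)) (huH.continuousAt.eventually_ne hu0))
  -- `f` is the slice b(y₀, ·), with N its order of vanishing at c. For y near y₀ the quotient b/f
  -- is close to 1 on the annulus R/4 ≤ |t - c| ≤ 3R/4, so its principal logarithm is holomorphic
  -- there.
  let f : ℂ → ℂ := fun t => (t - c) ^ N * u t
  have hfb : ∀ t ∈ closedBall c R, b (y₀, t) = f t := fun t ht => (hRall ht).1.2.1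
  have hud : ∀ t ∈ closedBall c R, DifferentiableAt ℂ u t := fun t ht => (hRall ht).1.2.2
  have hun : ∀ t ∈ closedBall c R, u t ≠ 0 := fun t ht => (hRall ht).2
  have hbH : ∀ t ∈ closedBall c R, HolAt b (y₀, t) := fun t ht => (hRall ht).1.1.2
  have hf0 : ∀ t ∈ closedBall c R, t ≠ c → f t ≠ 0 := fun t ht htc =>
    mul_ne_zero (pow_ne_zero _ (sub_ne_zero.2 htc)) (hun t ht)
  have hfd : ∀ t ∈ closedBall c R, DifferentiableAt ℂ f t := fun t ht =>
    DifferentiableAt.mul (by fun_prop) (hud t ht)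
  have hK1 : IsCompact (closedBall c (3 * R / 4)) := isCompact_closedBall _ _
  have hK1R : closedBall c (3 * R / 4) ⊆ closedBall c R := closedBall_subset_closedBall (by linarith)
  have ev1 := hK1.eventually_forall_of_forall_eventually (x₀ := y₀)
    (P := fun y t => HolAt b (y, t)) fun t ht => (hbH t (hK1R ht)).eventually
  have hK2 : IsCompact (closedBall c (3 * R / 4) \ ball c (R / 4)) := hK1.diff isOpen_ball
  have hKc : ∀ t, R / 4 ≤ dist t c → t ≠ c := by
    rintro t ht rfl
    rw [dist_self] at ht; linarith
  have ev2 := hK2.eventually_forall_of_forall_eventually (x₀ := y₀)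
    (P := fun y t => ‖b (y, t) / f t - 1‖ < 1) (by
      rintro t ⟨ht, ht'⟩
      have htc : t ≠ c := hKc t (by simpa using ht')
      have h1 : ContinuousAt (fun z : E × ℂ => ‖b (z.1, z.2) / f z.2 - 1‖) (y₀, t) := by
        refine ContinuousAt.norm (ContinuousAt.sub (ContinuousAt.div ?_ ?_ ?_) continuousAt_const)
        · exact (hbH t (hK1R ht)).continuousAt
        · exact ContinuousAt.comp (g := f) (f := Prod.snd) (hfd t (hK1R ht)).continuousAt
            continuousAt_snd
        · exact hf0 t (hK1R ht) htc
      refine h1.eventually_lt continuousAt_const ?_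
      simp [hfb t (hK1R ht), hf0 t (hK1R ht) htc])
  obtain ⟨S, hSsub, hS, hyS⟩ := _root_.eventually_nhds_iff.1 (ev1.and ev2)
  have hbd : ∀ y ∈ S, ∀ t, dist t c ≤ 3 * R / 4 → HolAt b (y, t) := fun y hy t ht =>
    (hSsub y hy).1 t ht
  have hratio : ∀ y ∈ S, ∀ t, R / 4 ≤ dist t c → dist t c ≤ 3 * R / 4 →
      b (y, t) / f t ∈ Complex.slitPlane := by
    intro y hy t h1 h2
    have := Complex.mem_slitPlane_of_norm_lt_one ((hSsub y hy).2 t ⟨h2, by simpa using h1⟩)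
    simpa using this
  let Ψ : E × ℂ → ℂ := fun q => Complex.log (b q / f q.2)
  have hΨ : ∀ y ∈ S, ∀ t, R / 4 ≤ dist t c → dist t c ≤ 3 * R / 4 →
      DifferentiableAt ℂ Ψ (y, t) := by
    intro y hy t h1 h2
    have htR : t ∈ closedBall c R := hK1R h2
    refine DifferentiableAt.clog (DifferentiableAt.div_scalar (hbd y hy t h2).differentiableAt ?_ ?_)
      (hratio y hy t h1 h2)
    · exact DifferentiableAt.comp (g := f) (f := Prod.snd) (y, t) (hfd t htR) differentiableAt_snd
    · exact hf0 t htR (hKc t h1)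
  -- Laurent splitting log(b/f) = Hp + Hm on the annulus: Hp is holomorphic inside the outer circle,
  -- Hm outside the inner one, with Hm → 0 at infinity.
  let Hp : E × ℂ → ℂ := fun q =>
    (2 * Real.pi * Complex.I)⁻¹ * ∮ ζ in C(c, 3 * R / 4), Ψ (q.1, ζ) / (ζ - q.2)
  let Hm : E × ℂ → ℂ := fun q =>
    -(2 * Real.pi * Complex.I)⁻¹ * ∮ ζ in C(c, R / 4), Ψ (q.1, ζ) / (ζ - q.2)
  have hHp : DifferentiableOn ℂ Hp (S ×ˢ (sphere c (3 * R / 4))ᶜ) :=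
    (differentiableOn_cauchyTransform hS (by positivity) fun y hy ζ hζ => hΨ y hy ζ
      (by rw [mem_sphere.1 hζ]; linarith) (mem_sphere.1 hζ).le).const_mul _
  have hHm : DifferentiableOn ℂ Hm (S ×ˢ (sphere c (R / 4))ᶜ) :=
    (differentiableOn_cauchyTransform hS (by positivity) fun y hy ζ hζ => hΨ y hy ζ
      (mem_sphere.1 hζ).ge (by rw [mem_sphere.1 hζ]; linarith)).const_mul _
  have hHp' : ∀ y ∈ S, ∀ t ∈ ball c (3 * R / 4), HolAt Hp (y, t) := fun y hy t ht =>
    HolAt.of_differentiableOn hHp ((hS.prod isClosed_sphere.isOpen_compl).mem_nhds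
      ⟨hy, (mem_ball.1 ht).ne⟩)
  have hHm' : ∀ y ∈ S, ∀ t, R / 4 < dist t c → HolAt Hm (y, t) := fun y hy t ht =>
    HolAt.of_differentiableOn hHm ((hS.prod isClosed_sphere.isOpen_compl).mem_nhds
      ⟨hy, ht.ne'⟩)
  have hsplit : ∀ y ∈ S, ∀ t, R / 4 < dist t c → dist t c < 3 * R / 4 →
      Ψ (y, t) = Hp (y, t) + Hm (y, t) := by
    intro y hy t h1 h2
    have := two_pi_I_mul_eq_sub_of_annulus (f := fun ζ => Ψ (y, ζ)) (c := c) (t := t)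
      (r₁ := R / 4) (r₂ := 3 * R / 4) (by positivity) (fun z hz1 hz2 =>
        (hΨ y hy z hz1 hz2).comp z (f := fun z => (y, z)) (by fun_prop)) h1 h2
    simp only [Hp, Hm]
    field_simp
    linear_combination this
  let P₁ : E × ℂ → ℂ := fun q => (u q.2 * Complex.exp (Hp q))⁻¹ * b q
  let P₂ : E × ℂ → ℂ := fun q => (q.2 - c) ^ N * Complex.exp (Hm q)
  have hP12 : ∀ y ∈ S, ∀ t, R / 4 < dist t c → dist t c < 3 * R / 4 → P₁ (y, t) = P₂ (y, t) := by
    intro y hy t h1 h2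
    have htR : t ∈ closedBall c R := hK1R h2.le
    have hexp : Complex.exp (Hp (y, t)) * Complex.exp (Hm (y, t)) = b (y, t) / f t := by
      rw [← Complex.exp_add, ← hsplit y hy t h1 h2]
      exact Complex.exp_log (Complex.slitPlane_ne_zero (hratio y hy t h1.le h2.le))
    have hft := hf0 t htR (hKc t h1.le)
    have hut := hun t htR
    rw [eq_div_iff hft] at hexp
    simp only [P₁, P₂]
    rw [inv_mul_eq_iff_eq_mul₀ (mul_ne_zero hut (Complex.exp_ne_zero _)), ← hexp]
    simp only [f]
    ring
  -- Since b = (t - c)^N u e^{Hp} e^{Hm} on the annulus, `P₁` and `P₂` agree there, and any cut-off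
  -- radius between R/4 and 3R/4 would do. The first formula shows that P is b times a unit inside,
  -- the second gives P ~ t^N at infinity.
  let P : E × ℂ → ℂ := fun q => if dist q.2 c < R / 2 then P₁ q else P₂ q
  have hPeq1 : ∀ y ∈ S, ∀ t, dist t c < 3 * R / 4 → P =ᶠ[𝓝 (y, t)] P₁ := by
    intro y hy t ht
    filter_upwards [(hS.prod isOpen_ball).mem_nhds (⟨hy, ht⟩ : (y, t) ∈ S ×ˢ ball c (3 * R / 4))]
      with q hq
    by_cases h : dist q.2 c < R / 2
    · simp [P, h]
    · simp only [P, h, if_false]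
      exact (hP12 q.1 hq.1 q.2 (by linarith) hq.2).symm
  have hPeq2 : ∀ y ∈ S, ∀ t, R / 4 < dist t c → P =ᶠ[𝓝 (y, t)] P₂ := by
    intro y hy t ht
    filter_upwards [(hS.prod isClosed_closedBall.isOpen_compl).mem_nhds
      (⟨hy, by simpa using ht⟩ : (y, t) ∈ S ×ˢ (closedBall c (R / 4))ᶜ)] with q hq
    by_cases h : dist q.2 c < R / 2
    · simp only [P, h, if_true]
      exact hP12 q.1 hq.1 q.2 (by simpa using hq.2) (by linarith)
    · simp [P, h]
  have hunit : ∀ y ∈ S, ∀ t, dist t c < 3 * R / 4 →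
      HolAt (fun q : E × ℂ => (u q.2 * Complex.exp (Hp q))⁻¹) (y, t) := by
    intro y hy t ht
    have huq : HolAt (fun q : E × ℂ => u q.2) (y, t) := by
      refine HolAt.comp (φ := u) (ψ := Prod.snd) ?_ (differentiable_snd.holAt _)
      filter_upwards [isOpen_ball.mem_nhds (mem_ball.2 ht : t ∈ ball c (3 * R / 4))] with s hs
      exact hud s (hK1R (ball_subset_closedBall hs))
    exact (huq.mul ((Complex.differentiable_exp.holAt _).comp (hHp' y hy t ht))).inv
      (mul_ne_zero (hun t (hK1R ht.le)) (Complex.exp_ne_zero _))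
  refine ⟨R / 2, by positivity, ?_, S, hS, hyS, P, ?_, ?_, ?_, N, ?_⟩
  · intro t ht
    exact (hRall (closedBall_subset_closedBall (by linarith) ht)).1.1.1
  · rintro ⟨y, t⟩ ⟨hy, -⟩
    refine DifferentiableAt.differentiableWithinAt ?_
    by_cases h : dist t c < 3 * R / 4
    · refine DifferentiableAt.congr_of_eventuallyEq ?_ (hPeq1 y hy t h)
      exact ((hunit y hy t h).mul (hbd y hy t h.le)).differentiableAt
    · have h' : R / 4 < dist t c := by linarith
      refine DifferentiableAt.congr_of_eventuallyEq ?_ (hPeq2 y hy t h')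
      exact DifferentiableAt.mul (by fun_prop) (hHm' y hy t h').differentiableAt.cexp
  · intro y hy t ht
    have ht' : dist t c < 3 * R / 4 := by
      have := mem_ball.1 ht
      linarith
    exact ⟨_, hunit y hy t ht', inv_ne_zero (mul_ne_zero (hun t (hK1R ht'.le))
      (Complex.exp_ne_zero _)), hPeq1 y hy t ht'⟩
  · intro y hy t ht
    have ht' : ¬dist t c < R / 2 := ht
    simp only [P, ht', if_false, P₂]
    refine mul_ne_zero (pow_ne_zero _ (sub_ne_zero.2 (hKc t (by linarith)))) (Complex.exp_ne_zero _)
  · intro y hy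
    have hHmlim : Tendsto (fun t => Hm (y, t)) (cocompact ℂ) (𝓝 0) := by
      have := (tendsto_cauchyTransform (c := c) (r := R / 4) (by positivity)
        (f := fun ζ => Ψ (y, ζ)) (by
          intro ζ hζ
          exact ((hΨ y hy ζ (mem_sphere.1 hζ).ge (by rw [mem_sphere.1 hζ]; linarith)).comp ζ
            (f := fun z => (y, z)) (by fun_prop)).continuousAt.continuousWithinAt)).const_mul
        (-(2 * Real.pi * Complex.I)⁻¹)
      simpa [Hm] using this
    have hlin : Tendsto (fun t : ℂ => (1 - c * t⁻¹) ^ N) (cocompact ℂ) (𝓝 1) := by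
      have : Tendsto (fun t : ℂ => t⁻¹) (cocompact ℂ) (𝓝 0) := by
        rw [← Metric.cobounded_eq_cocompact]
        exact tendsto_inv₀_cobounded
      have := (tendsto_const_nhds (x := (1 : ℂ)).sub (this.const_mul c)).pow N
      simpa using this
    have hmain := hlin.mul hHmlim.cexp
    simp only [Complex.exp_zero, mul_one] at hmain
    refine hmain.congr' ?_
    have hlarge : ∀ᶠ t : ℂ in cocompact ℂ, ‖c‖ + R < ‖t‖ :=
      tendsto_norm_cocompact_atTop.eventually_gt_atTop _
    filter_upwards [hlarge] with t ht
    have htd : ¬dist t c < R / 2 := by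
      rw [dist_eq_norm]
      have := norm_sub_norm_le t c
      linarith
    have ht0 : t ≠ 0 := by
      rintro rfl
      rw [norm_zero] at ht
      linarith [norm_nonneg c]
    simp only [P, htd, if_false, P₂]
    have : (1 - c * t⁻¹) = (t - c) / t := by field_simp
    rw [this, div_pow]
    ring

end Weierstrass

/-! ### Effective divisors and their restriction to curves -/

section Divisor

variable {X : Type*} [NormedAddCommGroup X] [NormedSpace ℂ X]

/-- An effective divisor on `Ω`, given by a local equation `B p` near every point `p` of `Ω`. -/
structure IsDivisor (B : X → X → ℂ) (Ω : Set X) : Prop where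
  holAt : ∀ p ∈ Ω, HolAt (B p) p
  nonzeroGerm : ∀ p ∈ Ω, NonzeroGerm (B p) p
  compat : ∀ p ∈ Ω, ∀ᶠ q in 𝓝 p, Assoc (B q) (B p) q

theorem IsDivisor.eventually_assoc_one {B : X → X → ℂ} {Ω : Set X} (hB : IsDivisor B Ω) {p : X}
    (hp : p ∈ Ω) (h0 : B p p ≠ 0) : ∀ᶠ q in 𝓝 p, Assoc (B q) (fun _ => 1) q := by
  filter_upwards [hB.compat p hp, (Assoc.of_ne (hB.holAt p hp) h0).eventually] with q h1 h2
  exact h1.trans h2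

theorem Assoc.ne_zero {φ : X → ℂ} {p : X} (h : Assoc φ (fun _ => 1) p) : φ p ≠ 0 := fun h0 =>
  one_ne_zero (α := ℂ) (h.eq_zero_iff.1 h0)

theorem IsDivisor.comp_equiv {Y : Type*} [NormedAddCommGroup Y] [NormedSpace ℂ Y]
    {B : X → X → ℂ} {Ω : Set X} (hB : IsDivisor B Ω) (e : Y ≃L[ℂ] X) :
    IsDivisor (fun p z => B (e p) (e z)) (e ⁻¹' Ω) where
  holAt p hp := (hB.holAt _ hp).comp_clm (e : Y →L[ℂ] X)
  nonzeroGerm p hp := by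
    have h : ∃ᶠ z in map e (𝓝 p), B (e p) z ≠ 0 := by
      rw [e.map_nhds_eq]; exact hB.nonzeroGerm _ hp
    exact frequently_map.1 h
  compat p hp := by
    filter_upwards [e.continuous.continuousAt.eventually (hB.compat _ hp)] with q hq
    exact hq.comp (e.differentiable.holAt q)

/-- On a curve, a divisor either contains a neighbourhood of a point or is discrete there. -/
theorem IsDivisor.dichotomy {B : X → X → ℂ} {Ω : Set X} (hB : IsDivisor B Ω) {A : ℂ → X}
    (hA : Differentiable ℂ A) {t : ℂ} (ht : A t ∈ Ω) :
    (∀ᶠ s in 𝓝 t, B (A s) (A s) = 0) ∨ ∀ᶠ s in 𝓝[≠] t, B (A s) (A s) ≠ 0 := by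
  have hiff : ∀ᶠ s in 𝓝 t, (B (A s) (A s) = 0 ↔ B (A t) (A s) = 0) :=
    hA.continuous.continuousAt.eventually ((hB.compat _ ht).mono fun q hq => hq.eq_zero_iff)
  have han : AnalyticAt ℂ (fun s => B (A t) (A s)) t :=
    Complex.analyticAt_iff_eventually_differentiableAt.2 ((hB.holAt _ ht).comp (hA.holAt t))
  rcases han.eventually_eq_zero_or_eventually_ne_zero with h | h
  · left
    filter_upwards [hiff, h] with s h1 h2 using h1.2 h2
  · right
    filter_upwards [hiff.filter_mono nhdsWithin_le_nhds, h] with s h1 h2 using fun h3 => h2 (h1.1 h3)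

/-- By `IsDivisor.dichotomy` the parameters near which the curve lies inside the divisor form an
open set that is relatively closed in T. As T is connected and s₀ is not in this set, no point of T
is. -/
theorem IsDivisor.eventually_ne {B : X → X → ℂ} {Ω : Set X} (hB : IsDivisor B Ω) {A : ℂ → X}
    (hA : Differentiable ℂ A) {T : Set ℂ} (hT : IsPreconnected T)
    (hTΩ : ∀ t ∈ T, A t ∈ Ω) {s₀ : ℂ} (hs₀ : s₀ ∈ T) (hne : B (A s₀) (A s₀) ≠ 0) :
    ∀ t ∈ T, ∀ᶠ s in 𝓝[≠] t, B (A s) (A s) ≠ 0 := by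
  let W : Set ℂ := {t | ∀ᶠ s in 𝓝 t, B (A s) (A s) = 0}
  have hW : IsOpen W := isOpen_iff_mem_nhds.2 fun t ht => eventually_eventually_nhds.2 ht
  have hcl : closure W ∩ T ⊆ W := by
    rintro t ⟨htW, htT⟩
    rcases hB.dichotomy hA (hTΩ t htT) with h | h
    · exact h
    · exfalso
      rw [eventually_nhdsWithin_iff] at h
      obtain ⟨s, hs, hsW⟩ := ((mem_closure_iff_frequently.1 htW).and_eventually
        (eventually_eventually_nhds.2 h)).exists
      have h3 : ∀ᶠ r in 𝓝 s, r = t := by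
        filter_upwards [hs, hsW] with r h1 h2
        by_contra hr
        exact h2 hr h1
      have h4 : ∀ᶠ r in 𝓝[≠] s, False := by
        have hst : s = t := h3.self_of_nhds
        rw [eventually_nhdsWithin_iff]
        filter_upwards [h3] with r hr hr'
        exact hr' (hr.trans hst.symm)
      exact (NormedField.nhdsNE_neBot s).ne (by simpa using h4)
  intro t ht
  refine (hB.dichotomy hA (hTΩ t ht)).resolve_left fun h => ?_
  exact hne (hT.subset_of_closure_inter_subset hW ⟨t, ht, h⟩ hcl hs₀).self_of_nhds

theorem finite_inter_of_eventually_notMem {K Z : Set ℂ} (hK : IsCompact K)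
    (h : ∀ t ∈ K, ∀ᶠ s in 𝓝[≠] t, s ∉ Z) : (K ∩ Z).Finite := by
  by_contra hinf
  obtain ⟨x, hx, hacc⟩ := Set.Infinite.exists_accPt_of_subset_isCompact hinf hK inter_subset_left
  have := accPt_iff_frequently_nhdsNE.1 hacc
  obtain ⟨s, h1, h2⟩ := (this.and_eventually (h x hx)).exists
  exact h2 h1.2

end Divisor

/-! ### Normalised equations over discs and extension to the origin -/

section Disc

set_option linter.unusedSectionVars false

variable {E : Type*} [NormedAddCommGroup E] [NormedSpace ℂ E] [FiniteDimensional ℂ E]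

theorem holAt_mk (y : E) (t : ℂ) : HolAt (fun s : ℂ => (y, s)) t :=
  Differentiable.holAt (by fun_prop) t

/-- Preparation is applied to the single local equation at (y₀, c). Shrinking to a product
neighbourhood where compatibility holds makes the result an equation of the divisor at the
neighbouring points too. -/
theorem IsDivisor.exists_weierstrass_point {B : E × ℂ → E × ℂ → ℂ} {Ω : Set (E × ℂ)}
    (hB : IsDivisor B Ω) {y₀ : E} {c : ℂ} (hc : (y₀, c) ∈ Ω)
    (h0 : ∀ᶠ t in 𝓝[≠] c, B (y₀, t) (y₀, t) ≠ 0) {V : Set ℂ} (hV : V ∈ 𝓝 c) :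
    ∃ ρ > 0, closedBall c ρ ⊆ V ∧ ∃ S : Set E, IsOpen S ∧ y₀ ∈ S ∧ ∃ P : E × ℂ → ℂ,
      DifferentiableOn ℂ P (S ×ˢ univ) ∧
      (∀ y ∈ S, ∀ t ∈ ball c ρ, Assoc P (B (y, t)) (y, t)) ∧
      (∀ y ∈ S, ∀ t ∉ ball c ρ, P (y, t) ≠ 0) ∧
      ∃ N : ℕ, ∀ y ∈ S, Tendsto (fun t => P (y, t) / t ^ N) (cocompact ℂ) (𝓝 1) := by
  obtain ⟨S₁, V₁, hS₁, hyS₁, hV₁, hcV₁, hSV⟩ := mem_nhds_prod_iff'.1 (hB.compat _ hc)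
  obtain ⟨ρ, hρ, hρV, S, hS, hyS, P, hP, hPa, hPn, hPl⟩ :=
    exists_weierstrass (V := V ∩ V₁) (hB.holAt _ hc) (by
      have h1 : ∀ᶠ t in 𝓝[≠] c, t ∈ V₁ := mem_nhdsWithin_of_mem_nhds (hV₁.mem_nhds hcV₁)
      have h2 : ∀ᶠ t in 𝓝[≠] c, B (y₀, c) (y₀, t) ≠ 0 := by
        filter_upwards [h0, h1] with t h2 h3 h4
        exact h2 ((hSV (show (y₀, t) ∈ S₁ ×ˢ V₁ from ⟨hyS₁, h3⟩)).eq_zero_iff.2 h4)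
      exact h2.frequently.filter_mono nhdsWithin_le_nhds)
      (inter_mem hV (hV₁.mem_nhds hcV₁))
  refine ⟨ρ, hρ, hρV.trans inter_subset_left, S ∩ S₁, hS.inter hS₁, ⟨hyS, hyS₁⟩, P,
    hP.mono (prod_mono inter_subset_left le_rfl), ?_, fun y hy => hPn y hy.1,
    hPl.imp fun N hN y hy => hN y hy.1⟩
  intro y hy t ht
  exact (hPa y hy.1 t ht).trans (hSV (show (y, t) ∈ S₁ ×ˢ V₁ from
    ⟨hy.2, (hρV (ball_subset_closedBall ht)).2⟩)).symm

/-- The normalised equation of a divisor on a neighbourhood of a closed disc. -/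
theorem IsDivisor.exists_weierstrass_disc {B : E × ℂ → E × ℂ → ℂ} {Ω : Set (E × ℂ)}
    (hB : IsDivisor B Ω) {y₀ : E} {ε : ℝ} (hε : 0 < ε)
    (hΩ : ∀ t ∈ closedBall (0 : ℂ) ε, (y₀, t) ∈ Ω)
    (hne : ∀ t ∈ sphere (0 : ℂ) ε, B (y₀, t) (y₀, t) ≠ 0) :
    ∃ S : Set E, IsOpen S ∧ y₀ ∈ S ∧ ∃ P : E × ℂ → ℂ,
      DifferentiableOn ℂ P (S ×ˢ univ) ∧
      (∀ y ∈ S, ∀ t ∈ ball (0 : ℂ) ε, Assoc P (B (y, t)) (y, t)) ∧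
      (∀ y ∈ S, ∀ t ∉ ball (0 : ℂ) ε, P (y, t) ≠ 0) ∧
      ∃ N : ℕ, ∀ y ∈ S, Tendsto (fun t => P (y, t) / t ^ N) (cocompact ℂ) (𝓝 1) := by
  classical
  have hA : Differentiable ℂ (fun s : ℂ => (y₀, s)) := by fun_prop
  have hopen : ∀ t ∈ closedBall (0 : ℂ) ε, B (y₀, t) (y₀, t) ≠ 0 →
      ∀ᶠ s in 𝓝 t, B (y₀, s) (y₀, s) ≠ 0 := fun t ht h =>
    (hA.continuous.continuousAt.eventually (hB.eventually_assoc_one (hΩ t ht) h)).mono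
      fun s hs => hs.ne_zero
  obtain ⟨s₀, hs₀, hs₀n⟩ : ∃ s ∈ ball (0 : ℂ) ε, B (y₀, s) (y₀, s) ≠ 0 := by
    have hmem : (ε : ℂ) ∈ sphere (0 : ℂ) ε := by simp [abs_of_pos hε]
    have hcl : (ε : ℂ) ∈ closure (ball (0 : ℂ) ε) := by
      rw [closure_ball _ hε.ne']; exact sphere_subset_closedBall hmem
    obtain ⟨s, h1, h2⟩ := ((mem_closure_iff_frequently.1 hcl).and_eventually
      (hopen _ (sphere_subset_closedBall hmem) (hne _ hmem))).exists
    exact ⟨s, h1, h2⟩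
  have hdisc : ∀ t ∈ closedBall (0 : ℂ) ε, ∀ᶠ s in 𝓝[≠] t, B (y₀, s) (y₀, s) ≠ 0 := by
    intro t ht
    rcases (mem_closedBall.1 ht).lt_or_eq with h | h
    · exact hB.eventually_ne hA (convex_ball (0 : ℂ) ε).isPreconnected
        (fun t ht => hΩ t (ball_subset_closedBall ht)) hs₀ hs₀n t h
    · exact (hopen t ht (hne t h)).filter_mono nhdsWithin_le_nhds
  have hfin := finite_inter_of_eventually_notMem (isCompact_closedBall (0 : ℂ) ε)
    (Z := {s | B (y₀, s) (y₀, s) = 0}) hdisc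
  set Z := closedBall (0 : ℂ) ε ∩ {s | B (y₀, s) (y₀, s) = 0} with hZ
  have hZball : ∀ t ∈ Z, t ∈ ball (0 : ℂ) ε := by
    rintro t ⟨h1, h2⟩
    exact lt_of_le_of_ne h1 fun h3 => hne t h3 h2
  -- The finitely many zeros on the slice get disjoint small discs, and the equation sought is the
  -- product of their Weierstrass functions. Off these discs the slice is compact and misses the
  -- divisor, so the same holds for y near y₀.
  obtain ⟨U, hU, hUd⟩ := hfin.t2_separation
  have hloc := fun t (ht : t ∈ Z) => hB.exists_weierstrass_point (hΩ t ht.1) (hdisc t ht.1)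
    (V := U t ∩ ball 0 ε) (inter_mem ((hU t).2.mem_nhds (hU t).1) (isOpen_ball.mem_nhds (hZball t ht)))
  choose! ρ hρ hρV S hS hyS P hP hPa hPn N hPl using hloc
  have hKc : IsCompact (closedBall (0 : ℂ) ε \ ⋃ t ∈ Z, ball t (ρ t)) :=
    (isCompact_closedBall _ _).diff (isOpen_biUnion fun t _ => isOpen_ball)
  have hev := hKc.eventually_forall_of_forall_eventually (x₀ := y₀)
    (P := fun y t => Assoc (B (y, t)) (fun _ => 1) (y, t)) (by
      rintro t ⟨ht, htn⟩
      refine hB.eventually_assoc_one (hΩ t ht) fun h0 => htn ?_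
      exact mem_biUnion (show t ∈ Z from ⟨ht, h0⟩) (mem_ball_self (hρ t ⟨ht, h0⟩)))
  obtain ⟨S', hS'sub, hS', hyS'⟩ := _root_.eventually_nhds_iff.1 hev
  set F := hfin.toFinset with hF
  have hFZ : ∀ t, t ∈ F ↔ t ∈ Z := fun t => hfin.mem_toFinset
  have hnotball : ∀ t ∈ Z, ∀ t' ∈ Z, t ≠ t' → ∀ s ∈ ball t (ρ t), s ∉ ball t' (ρ t') := by
    intro t ht t' ht' hne s hs hs'
    exact Set.disjoint_left.1 (hUd ht ht' hne) (hρV t ht (ball_subset_closedBall hs)).1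
      (hρV t' ht' (ball_subset_closedBall hs')).1
  have hST : ∀ t ∈ Z, ∀ y ∈ S' ∩ ⋂ t ∈ F, S t, y ∈ S t := fun t ht y hy =>
    mem_iInter₂.1 hy.2 t ((hFZ t).2 ht)
  have hPd : ∀ t ∈ Z, ∀ y ∈ S t, ∀ s, HolAt (P t) (y, s) := fun t ht y hy s =>
    HolAt.of_differentiableOn (hP t ht) (((hS t ht).prod isOpen_univ).mem_nhds ⟨hy, mem_univ s⟩)
  refine ⟨S' ∩ ⋂ t ∈ F, S t, hS'.inter (isOpen_biInter_finset fun t ht => hS t ((hFZ t).1 ht)),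
    ⟨hyS', mem_iInter₂.2 fun t ht => hyS t ((hFZ t).1 ht)⟩, fun q => ∏ t ∈ F, P t q, ?_, ?_, ?_,
    ∑ t ∈ F, N t, ?_⟩
  · rintro ⟨y, s⟩ ⟨hy, -⟩
    exact (holAt_finset_prod F fun t ht => hPd t ((hFZ t).1 ht) y
      (hST t ((hFZ t).1 ht) y hy) s).differentiableAt.differentiableWithinAt
  · intro y hy s hs
    by_cases hcase : ∃ t ∈ Z, s ∈ ball t (ρ t)
    · obtain ⟨t, ht, hst⟩ := hcase
      have h1 := hPa t ht y (hST t ht y hy) s hst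
      -- Each factor vanishes only in its own disc, so the other factors are units here.
      have h2 : Assoc (fun q => ∏ t' ∈ F.erase t, P t' q) (fun _ => 1) (y, s) := by
        refine Assoc.of_ne (holAt_finset_prod _ fun t' ht' => ?_)
          (Finset.prod_ne_zero_iff.2 fun t' ht' => ?_)
        · have := (hFZ t').1 (Finset.mem_of_mem_erase ht')
          exact hPd t' this y (hST t' this y hy) s
        · have h3 := (hFZ t').1 (Finset.mem_of_mem_erase ht')
          exact hPn t' h3 y (hST t' h3 y hy) s
            (hnotball t ht t' h3 (Finset.ne_of_mem_erase ht').symm s hst)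
      have h3 := h1.mul h2
      simp only [mul_one] at h3
      refine (Assoc.of_eventuallyEq (Eventually.of_forall fun q => ?_)).trans h3
      exact (Finset.mul_prod_erase F (fun t => P t q) ((hFZ t).2 ht)).symm
    · push Not at hcase
      refine (Assoc.of_ne (holAt_finset_prod _ fun t' ht' => ?_)
          (Finset.prod_ne_zero_iff.2 fun t' ht' => ?_)).trans
        (hS'sub y hy.1 s ⟨ball_subset_closedBall hs, ?_⟩).symm
      · have := (hFZ t').1 ht'
        exact hPd t' this y (hST t' this y hy) s
      · have h3 := (hFZ t').1 ht'
        exact hPn t' h3 y (hST t' h3 y hy) s (hcase t' h3)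
      · intro hmem
        obtain ⟨t, ht, hst⟩ := mem_iUnion₂.1 hmem
        exact hcase t ht hst
  · intro y hy s hs
    refine Finset.prod_ne_zero_iff.2 fun t ht => ?_
    have h3 := (hFZ t).1 ht
    exact hPn t h3 y (hST t h3 y hy) s fun hst =>
      hs (hρV t h3 (ball_subset_closedBall hst)).2
  · intro y hy
    have := tendsto_finsetProd F fun t ht => hPl t ((hFZ t).1 ht) y (hST t ((hFZ t).1 ht) y hy)
    simpa [Finset.prod_div_distrib, Finset.prod_pow_eq_pow_sum] using this

/-- Normalised entire functions with the same zeros are equal; here the degrees are ordered. -/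
theorem eq_of_assoc_of_tendsto_of_le {p q : ℂ → ℂ}
    (hq : Differentiable ℂ q) (hpq : ∀ t, Assoc p q t) {s : ℂ} (hqs : q s ≠ 0)
    {N M : ℕ} (hNM : N ≤ M)
    (hpN : Tendsto (fun t => p t / t ^ N) (cocompact ℂ) (𝓝 1))
    (hqM : Tendsto (fun t => q t / t ^ M) (cocompact ℂ) (𝓝 1)) : p = q := by
  have hnz : ∀ t, NonzeroGerm q t := by
    intro t h
    simp only [ne_eq, not_not] at h
    exact hqs (eq_zero_of_eventuallyEq_zero_of_convex isOpen_univ convex_univ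
      hq.differentiableOn (mem_univ t) h s (mem_univ s))
  obtain ⟨g, hg, hg'⟩ := exists_unit_of_assoc isOpen_univ (fun t _ => hpq t) (fun t _ => hnz t)
  have hgd : Differentiable ℂ g := fun t => (hg t (mem_univ t)).differentiableAt
  -- The entire unit g = p/q behaves like t^{-(M-N)} at infinity, so its limit is 1 if M = N and 0
  -- otherwise. Liouville makes g equal to this limit, and g ≠ 0 excludes the second case.
  have h1 : Tendsto (fun t : ℂ => t⁻¹ ^ (M - N)) (cocompact ℂ) (𝓝 (0 ^ (M - N))) := by
    have : Tendsto (fun t : ℂ => t⁻¹) (cocompact ℂ) (𝓝 0) := by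
      rw [← Metric.cobounded_eq_cocompact]
      exact tendsto_inv₀_cobounded
    exact this.pow _
  have h2 := (hpN.div hqM one_ne_zero).mul h1
  have h3 : Tendsto g (cocompact ℂ) (𝓝 (1 / 1 * 0 ^ (M - N))) := by
    refine h2.congr' ?_
    have hlarge : ∀ᶠ t : ℂ in cocompact ℂ, 0 < ‖t‖ :=
      tendsto_norm_cocompact_atTop.eventually_gt_atTop _
    filter_upwards [hlarge, hqM.eventually_ne one_ne_zero] with t ht hqt
    have ht0 : t ≠ 0 := norm_pos_iff.1 ht
    have hqt0 : q t ≠ 0 := by rintro h; simp [h] at hqt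
    have hM : t ^ M = t ^ N * t ^ (M - N) := by rw [← pow_add, Nat.add_sub_cancel' hNM]
    simp only [Pi.div_apply, (hg' t (mem_univ t)).2, hM, inv_pow]
    field_simp
  have h4 : ∀ t, g t = 1 / 1 * 0 ^ (M - N) := fun t => hgd.apply_eq_of_tendsto_cocompact t h3
  have h5 : (M - N) = 0 := by
    by_contra hne
    exact (hg' 0 (mem_univ 0)).1 (by rw [h4]; simp [hne])
  funext t
  rw [(hg' t (mem_univ t)).2, h4, h5]; simp

theorem eq_of_assoc_of_tendsto {p q : ℂ → ℂ} (hp : Differentiable ℂ p)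
    (hq : Differentiable ℂ q) {ε : ℝ} (hpq : ∀ t ∈ ball (0 : ℂ) ε, Assoc p q t)
    (hpn : ∀ t ∉ ball (0 : ℂ) ε, p t ≠ 0) (hqn : ∀ t ∉ ball (0 : ℂ) ε, q t ≠ 0) {N M : ℕ}
    (hpN : Tendsto (fun t => p t / t ^ N) (cocompact ℂ) (𝓝 1))
    (hqM : Tendsto (fun t => q t / t ^ M) (cocompact ℂ) (𝓝 1)) : p = q := by
  have hall : ∀ t, Assoc p q t := by
    intro t
    by_cases ht : t ∈ ball (0 : ℂ) ε
    · exact hpq t ht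
    · exact (Assoc.of_ne (hp.holAt t) (hpn t ht)).trans (Assoc.of_ne (hq.holAt t) (hqn t ht)).symm
  have hs : (ε : ℂ) ∉ ball (0 : ℂ) ε := by simp [le_abs_self]
  rcases le_total N M with h | h
  · exact eq_of_assoc_of_tendsto_of_le hq hall (hqn _ hs) h hpN hqM
  · exact (eq_of_assoc_of_tendsto_of_le hp (fun t => (hall t).symm) (hpn _ hs) h hqM hpN).symm

/-- A divisor on the complement of the origin extends to the origin. -/
theorem IsDivisor.exists_extension {B : E × ℂ → E × ℂ → ℂ} (hB : IsDivisor B {0}ᶜ)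
    (α β : E →L[ℂ] ℂ) {v w : E} (hv : α v = 1) (hβv : β v = 0) (hw : β w ≠ 0)
    {ε : ℝ} (hε : 0 < ε) (hne : ∀ t ∈ sphere (0 : ℂ) ε, B (0, t) (0, t) ≠ 0) :
    ∃ h : E × ℂ → ℂ, HolAt h 0 ∧ NonzeroGerm h 0 ∧ ∀ᶠ q in 𝓝 0, q ≠ 0 → Assoc h (B q) q := by
  have hev := (isCompact_sphere (0 : ℂ) ε).eventually_forall_of_forall_eventually (x₀ := (0 : E))
    (P := fun y t => Assoc (B (y, t)) (fun _ => 1) (y, t)) (by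
      intro t ht
      refine hB.eventually_assoc_one ?_ (hne t ht)
      rintro h0
      have : t = 0 := (Prod.ext_iff.1 h0).2
      subst this
      simp [hε.ne] at ht)
  obtain ⟨S₀, hS₀sub, hS₀, h0S₀⟩ := _root_.eventually_nhds_iff.1 hev
  have hmem : ∀ y : E, y ≠ 0 → ∀ t : ℂ, (y, t) ∈ ({0}ᶜ : Set (E × ℂ)) := fun y hy t h =>
    hy (Prod.ext_iff.1 h).1
  -- For y ≠ 0 the disc over y avoids the origin, and for y near 0 its boundary still misses the
  -- divisor.
  have hloc := fun y (hy : y ∈ S₀ \ {0}) => hB.exists_weierstrass_disc (y₀ := y) hε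
    (fun t _ => hmem y hy.2 t) (fun t ht => (hS₀sub y hy.1 t ht).ne_zero)
  choose! S hS hyS P hP hPa hPn N hPl using hloc
  let Q : E × ℂ → ℂ := fun q => P q.1 q
  have hslice : ∀ y ∈ S₀ \ {0}, ∀ y' ∈ S y, Differentiable ℂ fun t => P y (y', t) := by
    intro y hy y' hy' t
    exact ((hP y hy).differentiableAt (((hS y hy).prod isOpen_univ).mem_nhds
      ⟨hy', mem_univ t⟩)).comp t (f := fun t => (y', t)) (by fun_prop)
  -- Normalised equations of the same divisor on a slice coincide, even if their degrees are not
  -- known to agree beforehand. Hence the diagonal choice `Q` is locally one of the `P y`.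
  have hQ : ∀ y ∈ S₀ \ {0}, ∀ t, Q =ᶠ[𝓝 (y, t)] P y := by
    intro y hy t
    have hSo : IsOpen ((S₀ \ {0}) ∩ S y) := (hS₀.sdiff isClosed_singleton).inter (hS y hy)
    filter_upwards [(hSo.prod isOpen_univ).mem_nhds (⟨⟨hy, hyS y hy⟩, mem_univ t⟩ :
      (y, t) ∈ ((S₀ \ {0}) ∩ S y) ×ˢ univ)]
    rintro ⟨y', t'⟩ ⟨⟨hy', hy'S⟩, -⟩
    have := eq_of_assoc_of_tendsto (hslice y' hy' y' (hyS y' hy')) (hslice y hy y' hy'S)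
      (fun t ht => ((hPa y' hy' y' (hyS y' hy') t ht).trans (hPa y hy y' hy'S t ht).symm).comp
        (holAt_mk y' t)) (hPn y' hy' y' (hyS y' hy')) (hPn y hy y' hy'S)
      (hPl y' hy' y' (hyS y' hy')) (hPl y hy y' hy'S)
    exact congrFun this t'
  let Nz : Set (E × ℂ) := {q | q.1 = 0}
  have hNz : IsClosed Nz := isClosed_eq continuous_fst continuous_const
  have hS0' : ∀ᶠ q in 𝓝 (0 : E × ℂ), q.1 ∈ S₀ :=
    continuous_fst.continuousAt.eventually (hS₀.mem_nhds h0S₀)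
  have hball : ∀ᶠ q in 𝓝 (0 : E × ℂ), q.2 ∈ ball (0 : ℂ) ε :=
    continuous_snd.continuousAt.eventually (isOpen_ball.mem_nhds (mem_ball_self hε))
  have hQa : ∀ᶠ q in 𝓝 (0 : E × ℂ), q ∉ Nz → Assoc Q (B q) q := by
    filter_upwards [hS0', hball] with q h1 h2 h3
    exact (Assoc.of_eventuallyEq (hQ q.1 ⟨h1, h3⟩ q.2)).trans
      (hPa q.1 ⟨h1, h3⟩ q.1 (hyS q.1 ⟨h1, h3⟩) q.2 h2)
  let α' : E × ℂ →L[ℂ] ℂ := α.comp (ContinuousLinearMap.fst ℂ E ℂ)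
  let β' : E × ℂ →L[ℂ] ℂ := β.comp (ContinuousLinearMap.fst ℂ E ℂ)
  have hNab : ∀ x ∈ Nz, α' x = 0 ∧ β' x = 0 := by
    intro x hx
    have : x.1 = 0 := hx
    simp [α', β', this]
  have hQd : ∀ᶠ q in 𝓝 (0 : E × ℂ), q ∉ Nz → DifferentiableAt ℂ Q q := by
    filter_upwards [hQa] with q h1 h3
    have hq0 : q ∈ ({0}ᶜ : Set (E × ℂ)) := hmem q.1 h3 q.2
    exact ((h1 h3).holAt (hB.holAt q hq0)).differentiableAt
  -- α and β are linearly independent on E, so the axis y = 0 lies in a subspace of codimension two.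
  -- This is where E must have dimension at least 2.
  obtain ⟨Φ, hΦ, hΦQ⟩ := hartogs α' β' (v := (v, 0)) (w := (w, 0)) (by simpa [α'] using hv)
    (by simpa [β'] using hβv) (by simpa [β'] using hw) hNab (p := 0) (by simp) hQd
  have hΦa : ∀ᶠ q in 𝓝 (0 : E × ℂ), q ∉ Nz → Assoc Φ (B q) q := by
    filter_upwards [hQa, eventually_eventually_nhds.2 hΦQ] with q h1 h2 h3
    refine (Assoc.of_eventuallyEq ?_).trans (h1 h3)
    filter_upwards [h2, hNz.isOpen_compl.mem_nhds h3] with x h4 h5 using h4 h5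
  have hfinal : ∀ᶠ q in 𝓝 (0 : E × ℂ), q ≠ 0 → Assoc Φ (B q) q := by
    filter_upwards [hΦa, eventually_eventually_nhds.2 hΦa, hΦ.eventually] with q h1 h2 h3 hq
    by_cases hqN : q ∈ Nz
    -- On the punctured axis a local equation of the divisor already exists; it differs from Φ by a
    -- unit off the axis, hence also on it.
    · refine hartogs_assoc α' β' (v := (v, 0)) (w := (w, 0)) (by simpa [α'] using hv)
        (by simpa [β'] using hβv) (by simpa [β'] using hw) hNz hNab (hNab q hqN).1 h3
        (hB.holAt q hq) (hB.nonzeroGerm q hq) ?_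
      filter_upwards [h2, hB.compat q hq] with x h4 h5 h6
      exact (h4 h6).trans h5
    · exact h1 hqN
  refine ⟨Φ, hΦ, ?_, hfinal⟩
  have hneb : ∃ᶠ q in 𝓝 (0 : E × ℂ), q ≠ 0 := by
    have h1 : NonzeroGerm β' 0 := nonzeroGerm_clm β' (w := (w, 0)) (by simpa [β'] using hw) 0
    exact Frequently.mono h1 fun q hq h0 => hq (by simp [h0])
  refine frequently_frequently_nhds.1 ((hneb.and_eventually hfinal).mono ?_)
  rintro q ⟨hq, hqa⟩
  exact (hqa hq).nonzeroGerm (hB.nonzeroGerm q hq)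

end Disc

/-! ### An equation of the divisor at the origin of ℂⁿ -/

section ExtensionPi

variable {n : ℕ}

/-- The punctured line ℂ^*v is connected and not inside the divisor, so it meets the divisor in
finitely many points with 1/2 ≤ |t| ≤ 1, and some radius in that interval avoids them all. -/
theorem exists_radius_ne {n : ℕ} {B : (Fin n → ℂ) → (Fin n → ℂ) → ℂ} (hB : IsDivisor B {0}ᶜ)
    {v : Fin n → ℂ} (hv : v ≠ 0) (hBv : B v v ≠ 0) :
    ∃ ε : ℝ, 0 < ε ∧ ∀ t ∈ sphere (0 : ℂ) ε, B (t • v) (t • v) ≠ 0 := by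
  have hA : Differentiable ℂ (fun t : ℂ => t • v) := by fun_prop
  have hconn : IsPreconnected ({0}ᶜ : Set ℂ) :=
    (isConnected_compl_singleton_of_one_lt_rank (by simp) (0 : ℂ)).isPreconnected
  have hev := hB.eventually_ne hA hconn (fun t ht => smul_ne_zero ht hv) (s₀ := 1) (by simp)
    (by simpa using hBv)
  have hK : IsCompact (closedBall (0 : ℂ) 1 \ ball 0 (1 / 2)) :=
    (isCompact_closedBall _ _).diff isOpen_ball
  have hfin := finite_inter_of_eventually_notMem hK (Z := {t | B (t • v) (t • v) = 0}) (by
    rintro t ⟨-, ht⟩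
    refine hev t ?_
    rintro rfl
    exact ht (mem_ball_self (by norm_num)))
  have hinf : (Icc (1 / 2 : ℝ) 1).Infinite := Icc_infinite (by norm_num)
  obtain ⟨ε, hε, hεn⟩ := (hinf.sdiff (hfin.image norm)).nonempty
  refine ⟨ε, by linarith [hε.1], fun t ht h0 => hεn ⟨t, ⟨⟨?_, ?_⟩, h0⟩, by simpa using ht⟩⟩
  · have : ‖t‖ = ε := by simpa using ht
    simpa [this] using hε.2
  · have : ‖t‖ = ε := by simpa using ht
    simpa [this] using hε.1

/-- A divisor on `ℂⁿ ∖ {0}`, `n ≥ 3`, has an equation in a neighbourhood of the origin. -/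
theorem IsDivisor.exists_equation_at_zero (hn : 3 ≤ n) {B : (Fin n → ℂ) → (Fin n → ℂ) → ℂ}
    (hB : IsDivisor B {0}ᶜ) :
    ∃ h : (Fin n → ℂ) → ℂ, HolAt h 0 ∧ NonzeroGerm h 0 ∧
      ∀ᶠ z in 𝓝 0, z ≠ 0 → Assoc h (B z) z := by
  obtain ⟨v, hv, hBv⟩ : ∃ v : Fin n → ℂ, v ≠ 0 ∧ B v v ≠ 0 := by
    have h1 : (fun _ => 1 : Fin n → ℂ) ≠ 0 := fun h => by
      simpa using congrFun h ⟨0, by omega⟩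
    obtain ⟨v, h2, h3, h4⟩ := (Frequently.and_eventually (hB.nonzeroGerm _ h1)
      ((hB.compat _ h1).and (isOpen_compl_singleton.mem_nhds h1))).exists
    exact ⟨v, h4, fun h => h2 (h3.eq_zero_iff.1 h)⟩
  obtain ⟨ε, hε, hεn⟩ := exists_radius_ne hB hv hBv
  let e₀ : ((Fin (n - 1) → ℂ) × ℂ) ≃L[ℂ] (Fin n → ℂ) :=
    ContinuousLinearEquiv.ofFinrankEq (by
      rw [Module.finrank_prod, Module.finrank_fin_fun, Module.finrank_fin_fun, Module.finrank_self]
      omega)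
  -- A linear change of coordinates makes ℂv the last axis of ℂ^{n-1} × ℂ.
  obtain ⟨A, hA⟩ := SeparatingDual.exists_continuousLinearEquiv_apply_eq (R := ℂ)
    (x := e₀ (0, 1)) (y := v) (by simp) hv
  let e := e₀.trans A
  have he : ∀ t : ℂ, e (0, t) = t • v := by
    intro t
    have : ((0 : Fin (n - 1) → ℂ), t) = t • (0, 1) := by simp
    rw [this, map_smul]
    simp [e, hA]
  have hB' := hB.comp_equiv e
  have hpre : e ⁻¹' {0}ᶜ = {0}ᶜ := by
    ext z; simp
  rw [hpre] at hB'
  have h01 : (⟨0, by omega⟩ : Fin (n - 1)) ≠ ⟨1, by omega⟩ := by simp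
  obtain ⟨h, hh, hh0, hha⟩ := hB'.exists_extension
    (ContinuousLinearMap.proj (R := ℂ) (φ := fun _ : Fin (n - 1) => ℂ) ⟨0, by omega⟩)
    (ContinuousLinearMap.proj (R := ℂ) (φ := fun _ : Fin (n - 1) => ℂ) ⟨1, by omega⟩)
    (v := Pi.single ⟨0, by omega⟩ 1) (w := Pi.single ⟨1, by omega⟩ 1)
    (by simp) (by simp [h01.symm]) (by simp) hε (by
      intro t ht
      simpa only [he] using hεn t ht)
  have hs0 : e.symm 0 = 0 := map_zero _
  refine ⟨fun z => h (e.symm z), ?_, ?_, ?_⟩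
  · exact HolAt.comp_clm (e.symm : (Fin n → ℂ) →L[ℂ] (Fin (n - 1) → ℂ) × ℂ)
      (by simpa using hh)
  · have : ∃ᶠ z in map e.symm (𝓝 0), h z ≠ 0 := by
      rw [e.symm.map_nhds_eq, hs0]; exact hh0
    exact frequently_map.1 this
  · have h1 : Tendsto e.symm (𝓝 0) (𝓝 0) := by
      have := e.symm.continuous.tendsto 0
      rwa [hs0] at this
    filter_upwards [h1.eventually hha] with z hz hz0
    have h2 := (hz (by simpa using hz0)).comp (A := e.symm) (e.symm.differentiable.holAt z)
    simpa using h2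

end ExtensionPi

/-! ### Dividing germs by coordinates -/

section Monomial

variable {n : ℕ}

/-- The projection of `ℂⁿ` to the coordinate subspace of the coordinates in `s`. -/
noncomputable def coordProj (s : Finset (Fin n)) : (Fin n → ℂ) →L[ℂ] (Fin n → ℂ) :=
  ContinuousLinearMap.pi fun i => if i ∈ s then ContinuousLinearMap.proj i else 0

@[simp] theorem coordProj_apply (s : Finset (Fin n)) (z : Fin n → ℂ) (i : Fin n) :
    coordProj s z i = if i ∈ s then z i else 0 := by
  unfold coordProj
  by_cases h : i ∈ s <;> simp [h]

theorem coordProj_erase (k : Fin n) (z : Fin n → ℂ) :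
    coordProj (Finset.univ.erase k) z = Function.update z k 0 := by
  ext i
  by_cases h : i = k
  · subst h; simp
  · simp [h]

theorem tendsto_clm_zero {E F : Type*} [NormedAddCommGroup E] [NormedSpace ℂ E]
    [NormedAddCommGroup F] [NormedSpace ℂ F] (A : E →L[ℂ] F) : Tendsto A (𝓝 0) (𝓝 0) := by
  have := A.continuous.tendsto 0
  rwa [map_zero] at this

theorem HolAt.comp_clm_zero {E F : Type*} [NormedAddCommGroup E] [NormedSpace ℂ E]
    [NormedAddCommGroup F] [NormedSpace ℂ F] {g : F → ℂ} (hg : HolAt g 0) (A : E →L[ℂ] F) :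
    HolAt (fun z => g (A z)) 0 :=
  HolAt.comp_clm A (by rwa [map_zero])

/-- A holomorphic function that vanishes on a coordinate hyperplane is divisible by the
coordinate. -/
theorem exists_eq_coord_mul {g : (Fin n → ℂ) → ℂ} (hg : HolAt g 0) (k : Fin n)
    (h0 : ∀ᶠ z in 𝓝 0, g (coordProj (Finset.univ.erase k) z) = 0) :
    ∃ q : (Fin n → ℂ) → ℂ, HolAt q 0 ∧ ∀ᶠ z in 𝓝 0, g z = z k * q z := by
  obtain ⟨R, hR, hball⟩ := Metric.eventually_nhds_iff_ball.1 (hg.and h0)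
  let r := R / 2
  have hr : 0 < r := by positivity
  have hupd : ∀ z ∈ ball (0 : Fin n → ℂ) r, ∀ ζ ∈ closedBall (0 : ℂ) r,
      Function.update z k ζ ∈ ball (0 : Fin n → ℂ) R := by
    intro z hz ζ hζ
    rw [mem_ball_zero_iff] at hz ⊢
    rw [mem_closedBall_zero_iff] at hζ
    rw [pi_norm_lt_iff hR]
    intro i
    by_cases h : i = k
    · subst h; simp only [Function.update_self]; have : r < R := half_lt_self hR
      linarith
    · simp only [Function.update_of_ne h]
      have := (norm_le_pi_norm z i)
      have : r < R := half_lt_self hR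
      linarith
  have hA : Differentiable ℂ fun x : (Fin n → ℂ) × ℂ => Function.update x.1 k x.2 := by
    rw [differentiable_pi]
    intro i
    by_cases h : i = k
    · subst h; simp only [Function.update_self]; fun_prop
    · simp only [Function.update_of_ne h]; fun_prop
  have hgd : ∀ z ∈ ball (0 : Fin n → ℂ) r, ∀ ζ ∈ closedBall (0 : ℂ) r,
      DifferentiableAt ℂ g (Function.update z k ζ) := fun z hz ζ hζ =>
    (hball _ (hupd z hz ζ hζ)).1
  have hne : ∀ z ∈ ball (0 : Fin n → ℂ) r, ∀ ζ ∈ sphere (0 : ℂ) r, ζ - z k ≠ 0 := by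
    intro z hz ζ hζ h
    have h1 : ‖ζ‖ = r := by simpa using hζ
    rw [sub_eq_zero.1 h] at h1
    have h2 := norm_le_pi_norm z k
    rw [mem_ball_zero_iff] at hz
    linarith
  have hne0 : ∀ ζ ∈ sphere (0 : ℂ) r, ζ ≠ 0 := by
    rintro ζ hζ rfl
    exact hr.ne (by simpa using hζ)
  -- Cauchy's integral of g/ζ in the k-th variable. It is holomorphic in all variables and equals
  -- the difference quotient at 0 of the slice of g.
  let q : (Fin n → ℂ) → ℂ := fun z =>
    (2 * Real.pi * Complex.I)⁻¹ * ∮ ζ in C(0, r), (ζ - z k)⁻¹ * (ζ⁻¹ * g (Function.update z k ζ))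
  have hq : DifferentiableOn ℂ q (ball 0 r) := by
    refine (differentiableOn_circleIntegral isOpen_ball hr.le
      (G := fun x : (Fin n → ℂ) × ℂ => (x.2 - x.1 k)⁻¹ * (x.2⁻¹ * g (Function.update x.1 k x.2))) ?_ ?_).const_mul _
    · rintro ⟨z, ζ⟩ ⟨hz, hζ⟩
      have h1 : DifferentiableAt ℂ (fun x : (Fin n → ℂ) × ℂ => x.2 - x.1 k) (z, ζ) := by fun_prop
      have h2 := (hgd z hz ζ (sphere_subset_closedBall hζ)).comp (z, ζ) (hA (z, ζ))
      exact ((h1.inv (hne z hz ζ hζ)).mul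
        ((differentiableAt_snd.inv (hne0 ζ hζ)).mul h2)).continuousAt.continuousWithinAt
    · intro ζ hζ z hz
      have h1 : DifferentiableAt ℂ (fun x : (Fin n → ℂ) => ζ - x k) z := by fun_prop
      have h3 : DifferentiableAt ℂ (fun x : Fin n → ℂ => Function.update x k ζ) z :=
        (hA (z, ζ)).comp z (f := fun x => (x, ζ)) (by fun_prop)
      have h2 := (hgd z hz ζ (sphere_subset_closedBall hζ)).comp z h3
      exact ((h1.inv (hne z hz ζ hζ)).mul (h2.const_mul ζ⁻¹)).differentiableWithinAt
  refine ⟨q, HolAt.of_differentiableOn hq (ball_mem_nhds 0 hr), ?_⟩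
  filter_upwards [ball_mem_nhds 0 hr] with z hz
  let f : ℂ → ℂ := fun ζ => g (Function.update z k ζ)
  have hf : DifferentiableOn ℂ f (closedBall 0 r) := by
    intro ζ hζ
    have h3 : DifferentiableAt ℂ (fun ζ : ℂ => Function.update z k ζ) ζ :=
      (hA (z, ζ)).comp ζ (f := fun x => (z, x)) (by fun_prop)
    exact ((hgd z hz ζ hζ).comp ζ h3).differentiableWithinAt
  have hf0 : f 0 = 0 := by
    have := (hball z (ball_subset_ball (half_le_self hR.le) hz)).2
    rwa [coordProj_erase] at this
  have hzk : z k ∈ ball (0 : ℂ) r := by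
    rw [mem_ball_zero_iff] at hz ⊢
    exact (norm_le_pi_norm z k).trans_lt hz
  have hds := (Complex.differentiableOn_dslope (closedBall_mem_nhds (0 : ℂ) hr)).2 hf
  have hC := hds.circleIntegral_sub_inv_smul hzk
  have hqz : q z = dslope f 0 (z k) := by
    simp only [q]
    rw [inv_mul_eq_iff_eq_mul₀ Complex.two_pi_I_ne_zero, ← smul_eq_mul (2 * _ * _), ← hC]
    refine circleIntegral.integral_congr hr.le fun ζ hζ => ?_
    simp only [smul_eq_mul]
    rw [dslope_of_ne f (hne0 ζ hζ), slope_def_field, hf0, sub_zero, sub_zero, div_eq_inv_mul]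
  have := sub_smul_dslope f 0 (z k)
  rw [hf0, sub_zero, sub_zero, smul_eq_mul] at this
  rw [hqz, this]
  simp [f]

/-- Any v close enough to 0 with g v ≠ 0 works: the slice is holomorphic on a convex set containing
0 and 1. The finite order along the line bounds how often g can be divided by a coordinate. -/
theorem exists_line_nonzero {E : Type*} [NormedAddCommGroup E] [NormedSpace ℂ E] {g : E → ℂ}
    (hg : HolAt g 0) (h0 : NonzeroGerm g 0) :
    ∃ v : E, AnalyticAt ℂ (fun t : ℂ => g (t • v)) 0 ∧
      analyticOrderAt (fun t : ℂ => g (t • v)) 0 ≠ ⊤ := by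
  obtain ⟨R, hR, hball⟩ := Metric.eventually_nhds_iff_ball.1 hg
  obtain ⟨v, hv0, hv⟩ := (Frequently.and_eventually h0 (ball_mem_nhds 0 hR)).exists
  have hA : Differentiable ℂ fun t : ℂ => t • v := by fun_prop
  let T : Set ℂ := (fun t : ℂ => t • v) ⁻¹' ball 0 R
  have hT : IsOpen T := isOpen_ball.preimage hA.continuous
  have hTc : Convex ℝ T := by
    have : Convex ℝ ((LinearMap.toSpanSingleton ℂ E v).restrictScalars ℝ ⁻¹' ball 0 R) :=
      (convex_ball 0 R).linear_preimage _
    exact this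
  have hd : DifferentiableOn ℂ (fun t : ℂ => g (t • v)) T := fun t ht =>
    ((hball _ ht).comp t (hA t)).differentiableWithinAt
  have h0T : (0 : ℂ) ∈ T := by simpa [T] using hR
  refine ⟨v, (hd.analyticOnNhd hT) 0 h0T, fun htop => hv0 ?_⟩
  have := eq_zero_of_eventuallyEq_zero_of_convex hT hTc hd h0T (analyticOrderAt_eq_top.1 htop) 1
    (by simpa [T] using hv)
  simpa using this

/-- A nonzero germ is a power of a coordinate times a germ that does not vanish on the
coordinate hyperplane. -/
theorem exists_eq_coord_pow_mul {g : (Fin n → ℂ) → ℂ} (hg : HolAt g 0) (h0 : NonzeroGerm g 0)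
    (k : Fin n) :
    ∃ (d : ℕ) (q : (Fin n → ℂ) → ℂ), HolAt q 0 ∧ (∀ᶠ z in 𝓝 0, g z = z k ^ d * q z) ∧
      NonzeroGerm (fun z => q (coordProj (Finset.univ.erase k) z)) 0 := by
  obtain ⟨v, -, hv⟩ := exists_line_nonzero hg h0
  obtain ⟨M, hM⟩ := ENat.ne_top_iff_exists.1 hv
  replace hM : analyticOrderAt (fun t : ℂ => g (t • v)) 0 ≤ M := hM.ge
  clear hv h0
  -- `M` bounds the order of g along the fixed line ℂv. Each division by z_k lowers that order by at
  -- least one, so the divisions stop.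
  induction M generalizing g with
  | zero =>
    refine ⟨0, g, hg, by simp, ?_⟩
    have han : AnalyticAt ℂ (fun t : ℂ => g (t • v)) 0 :=
      Complex.analyticAt_iff_eventually_differentiableAt.2
        (HolAt.comp (ψ := fun t : ℂ => t • v) (by simpa using hg)
          (Differentiable.holAt (by fun_prop) 0))
    have hg0 : g 0 ≠ 0 := by
      simpa using han.analyticOrderAt_eq_zero.1 (le_antisymm (by simpa using hM) zero_le)
    exact NonzeroGerm.of_ne (by simpa using hg0) (hg.comp_clm_zero _).continuousAt
  | succ M ih =>
    by_cases hk : NonzeroGerm (fun z => g (coordProj (Finset.univ.erase k) z)) 0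
    · exact ⟨0, g, hg, by simp, hk⟩
    · obtain ⟨q, hq, hgq⟩ := exists_eq_coord_mul hg k (by simpa [NonzeroGerm] using hk)
      have hline : Tendsto (fun t : ℂ => t • v) (𝓝 0) (𝓝 0) := by
        have : Continuous fun t : ℂ => t • v := by fun_prop
        simpa using this.tendsto 0
      have hanq : AnalyticAt ℂ (fun t : ℂ => q (t • v)) 0 :=
        Complex.analyticAt_iff_eventually_differentiableAt.2
          (HolAt.comp (ψ := fun t : ℂ => t • v) (by simpa using hq)
            (Differentiable.holAt (by fun_prop) 0))
      have hanl : AnalyticAt ℂ (fun t : ℂ => t * v k) 0 := by fun_prop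
      have hord : analyticOrderAt (fun t : ℂ => g (t • v)) 0 =
          analyticOrderAt (fun t : ℂ => t * v k) 0 + analyticOrderAt (fun t : ℂ => q (t • v)) 0 := by
        rw [← analyticOrderAt_mul hanl hanq]
        refine analyticOrderAt_congr ?_
        filter_upwards [hline.eventually hgq] with t ht
        simpa using ht
      have hone : 1 ≤ analyticOrderAt (fun t : ℂ => t * v k) 0 := by
        rw [Order.one_le_iff_ne_zero, ne_eq, hanl.analyticOrderAt_eq_zero]
        simp
      have hqM : analyticOrderAt (fun t : ℂ => q (t • v)) 0 ≤ M := by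
        have h1 : 1 + analyticOrderAt (fun t : ℂ => q (t • v)) 0 ≤ 1 + (M : ℕ∞) := by
          calc _ ≤ analyticOrderAt (fun t : ℂ => t * v k) 0 +
                analyticOrderAt (fun t : ℂ => q (t • v)) 0 := by gcongr
            _ ≤ _ := by rw [← hord]; refine hM.trans ?_; push_cast; rw [add_comm]
        exact (ENat.add_le_add_iff_left (by simp)).1 h1
      obtain ⟨d, q', hq', he, hnz⟩ := ih hq hqM
      refine ⟨d + 1, q', hq', ?_, hnz⟩
      filter_upwards [hgq, he] with z h1 h2
      rw [h1, h2]; ring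

end Monomial

/-! ### Multiplicative independence and invariant divisors -/

section Multiplier

variable {n : ℕ}

theorem coordProj_comp (s t : Finset (Fin n)) (z : Fin n → ℂ) :
    coordProj s (coordProj t z) = coordProj (s ∩ t) z := by
  ext i
  by_cases h : i ∈ s <;> by_cases h' : i ∈ t <;> simp [h, h']

theorem coordProj_linear (F : DiagonalContraction n) (s : Finset (Fin n)) (z : Fin n → ℂ) :
    coordProj s (F.linear z) = F.linear (coordProj s z) := by
  ext i
  by_cases h : i ∈ s <;> simp [h, DiagonalContraction.linear]

theorem DiagonalContraction.linear_apply (F : DiagonalContraction n) (z : Fin n → ℂ) (i : Fin n) :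
    F.linear z i = F.mult i * z i := by simp [DiagonalContraction.linear]

theorem DiagonalContraction.linear_ne_zero (F : DiagonalContraction n) {z : Fin n → ℂ}
    (hz : z ≠ 0) : F.linear z ≠ 0 := by
  intro h
  refine hz (funext fun i => ?_)
  have := congrFun h i
  rw [F.linear_apply] at this
  exact (mul_eq_zero.1 this).resolve_left (F.mult_ne_zero i)

theorem nonzeroGerm_coord_pow (k : Fin n) (d : ℕ) (z : Fin n → ℂ) :
    NonzeroGerm (fun z : Fin n → ℂ => z k ^ d) z := by
  have h := nonzeroGerm_clm (ContinuousLinearMap.proj (R := ℂ) (φ := fun _ : Fin n => ℂ) k)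
    (w := Pi.single k 1) (by simp) z
  exact h.mono fun w hw => pow_ne_zero d (by simpa using hw)

theorem nonzeroGerm_monomial (s : Finset (Fin n)) (β : Fin n → ℕ) (z : Fin n → ℂ) :
    NonzeroGerm (fun z : Fin n → ℂ => ∏ i ∈ s, z i ^ β i) z := by
  classical
  induction s using Finset.induction_on with
  | empty => simpa using NonzeroGerm.of_ne (φ := fun _ : Fin n → ℂ => (1 : ℂ)) one_ne_zero continuousAt_const
  | insert k s hk ih =>
    simp only [Finset.prod_insert hk]
    exact (nonzeroGerm_coord_pow k (β k)  z).mul (Differentiable.holAt (by fun_prop) z) ih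
      (Differentiable.holAt (by fun_prop) z)

/-- Cancellation of a factor, as functions near a point. -/
theorem eventuallyEq_of_mul_eq {E : Type*} [NormedAddCommGroup E] [NormedSpace ℂ E]
    {m g g' : E → ℂ} {p : E} (hm : ∀ᶠ z in 𝓝 p, NonzeroGerm m z) (hg : HolAt g p)
    (hg' : HolAt g' p) (h : ∀ᶠ z in 𝓝 p, m z * g z = m z * g' z) : g =ᶠ[𝓝 p] g' := by
  filter_upwards [hm, hg, hg', eventually_eventually_nhds.2 h] with z h1 h2 h3 h4
  refine h1.cancel h2.continuousAt h3.continuousAt ?_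
  filter_upwards [h4] with w hw
  linear_combination hw

/-- Here g depends only on the coordinates in s. Remove the full power z_k^d and restrict the
quotient to z_k = 0: the result depends on one variable fewer and has multiplier μ_k^{-d} U. Once no
variable is left, g is a nonzero constant and U(0) = 1. The exponents β are the successive powers d;
if all are zero, nothing was divided out and g(0) ≠ 0. -/
theorem multiplier_of_coordProj (F : DiagonalContraction n) (s : Finset (Fin n)) :
    ∀ (g U : (Fin n → ℂ) → ℂ), HolAt g 0 → NonzeroGerm g 0 → HolAt U 0 →
      (∀ᶠ z in 𝓝 0, g (F.linear z) = U z * g z) → (∀ᶠ z in 𝓝 0, g (coordProj s z) = g z) →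
      ∃ β : Fin n → ℕ, (∀ k ∉ s, β k = 0) ∧ U 0 = ∏ i, F.mult i ^ β i ∧ (β = 0 → g 0 ≠ 0) := by
  classical
  induction s using Finset.induction_on with
  | empty =>
    intro g U hg h0 hU hgU hs
    have h1 : ∀ᶠ z in 𝓝 0, g 0 = g z := by
      filter_upwards [hs] with z hz
      have : coordProj (∅ : Finset (Fin n)) z = 0 := by ext i; simp
      rwa [this] at hz
    have hg0 : g 0 ≠ 0 := by
      obtain ⟨z, h2, h3⟩ := (Frequently.and_eventually h0 h1).exists
      rwa [h3]
    refine ⟨0, by simp, ?_, fun _ => hg0⟩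
    have := hgU.self_of_nhds
    rw [map_zero] at this
    have h4 : U 0 = 1 := by
      apply mul_right_cancel₀ hg0
      rw [← this, one_mul]
    simpa using h4
  | insert k s hk ih =>
    intro g U hg h0 hU hgU hs
    obtain ⟨d, q, hq, hgq, hnz⟩ := exists_eq_coord_pow_mul hg h0 k
    have hμ : F.mult k ^ d ≠ 0 := pow_ne_zero _ (F.mult_ne_zero k)
    have hm : ∀ᶠ z in 𝓝 (0 : Fin n → ℂ), NonzeroGerm (fun z : Fin n → ℂ => z k ^ d) z :=
      Eventually.of_forall fun z => nonzeroGerm_coord_pow k d z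
    have hqs : (fun z => q (coordProj (insert k s) z)) =ᶠ[𝓝 0] q := by
      refine eventuallyEq_of_mul_eq hm (hq.comp_clm_zero _) hq ?_
      filter_upwards [hs, hgq, (tendsto_clm_zero (coordProj (insert k s))).eventually hgq]
        with z h1 h2 h3
      rw [← h2, ← h1, h3]
      simp
    have hqF : (fun z => q (F.linear z)) =ᶠ[𝓝 0] fun z => (F.mult k ^ d)⁻¹ * U z * q z := by
      refine eventuallyEq_of_mul_eq hm (hq.comp_clm_zero _) (((holAt_const _ _).mul hU).mul hq) ?_
      filter_upwards [hgU, hgq, (tendsto_clm_zero F.linear).eventually hgq] with z h1 h2 h3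
      rw [h2, h3, F.linear_apply, mul_pow] at h1
      field_simp
      linear_combination h1
    have hks : (Finset.univ.erase k) ∩ insert k s = s := by
      ext i; by_cases h : i = k
      · subst h; simp [hk]
      · simp [h]
    have hqk : (fun z => q (coordProj (Finset.univ.erase k) z)) =ᶠ[𝓝 0]
        fun z => q (coordProj s z) := by
      filter_upwards [(tendsto_clm_zero (coordProj (Finset.univ.erase k))).eventually hqs] with z hz
      rw [← hz, coordProj_comp, Finset.inter_comm, hks]
    obtain ⟨β, hβs, hβU, hβ0⟩ := ih (fun z => q (coordProj s z))
      (fun z => (F.mult k ^ d)⁻¹ * U (coordProj s z)) (hq.comp_clm_zero _) (hnz.congr hqk)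
      ((holAt_const _ _).mul (hU.comp_clm_zero _)) (by
        filter_upwards [(tendsto_clm_zero (coordProj s)).eventually hqF] with z hz
        rw [coordProj_linear, hz]) (by
        refine Eventually.of_forall fun z => ?_
        rw [coordProj_comp, Finset.inter_self])
    refine ⟨β + Pi.single k d, ?_, ?_, ?_⟩
    · intro j hj
      have hjk : j ≠ k := fun h => hj (by simp [h])
      simp [hβs j fun h => hj (by simp [h]), hjk]
    · simp only [map_zero] at hβU
      rw [inv_mul_eq_iff_eq_mul₀ hμ] at hβU
      rw [hβU]
      simp only [Pi.add_apply, pow_add, Finset.prod_mul_distrib]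
      rw [mul_comm]
      congr 1
      rw [Finset.prod_eq_single k]
      · simp
      · intro j _ hj; simp [hj]
      · simp
    · intro h
      have hd : d = 0 := by
        have := congrFun h k
        simp at this
        exact this.2
      have hβ : β = 0 := by
        subst hd
        simpa using h
      have := hβ0 hβ
      rw [hgq.self_of_nhds, hd]
      simpa using this

/-- The coordinates are divided out one at a time. A later quotient still does not vanish
identically on an earlier hyperplane, since the earlier quotient is a multiple of it. -/
theorem exists_eq_monomial_mul {g : (Fin n → ℂ) → ℂ} (hg : HolAt g 0) (h0 : NonzeroGerm g 0)
    (s : Finset (Fin n)) :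
    ∃ (α : Fin n → ℕ) (q : (Fin n → ℂ) → ℂ), HolAt q 0 ∧
      (∀ᶠ z in 𝓝 0, g z = (∏ i, z i ^ α i) * q z) ∧
      ∀ k ∈ s, NonzeroGerm (fun z => q (coordProj (Finset.univ.erase k) z)) 0 := by
  classical
  induction s using Finset.induction_on with
  | empty => exact ⟨0, g, hg, by simp, by simp⟩
  | insert k s hk ih =>
    obtain ⟨α, q, hq, hgq, hnz⟩ := ih
    have hq0 : NonzeroGerm q 0 := by
      refine (Frequently.and_eventually h0 hgq).mono ?_
      rintro z ⟨h1, h2⟩ h3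
      exact h1 (by simp_all)
    obtain ⟨d, q', hq', hqq', hnz'⟩ := exists_eq_coord_pow_mul hq hq0 k
    refine ⟨α + Pi.single k d, q', hq', ?_, ?_⟩
    · filter_upwards [hgq, hqq'] with z h1 h2
      rw [h1, h2]
      simp only [Pi.add_apply, pow_add, Finset.prod_mul_distrib]
      rw [← mul_assoc]
      congr 2
      rw [Finset.prod_eq_single k]
      · simp
      · intro j _ hj; simp [hj]
      · simp
    · intro j hj
      rcases Finset.mem_insert.1 hj with rfl | hj
      · exact hnz'
      · refine (Frequently.and_eventually (hnz j hj)
          ((tendsto_clm_zero (coordProj (Finset.univ.erase j))).eventually hqq')).mono ?_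
        rintro z ⟨h1, h2⟩ h3
        exact h1 (by simp_all)

/-- Genericity: the multipliers are multiplicatively independent. -/
theorem DiagonalContraction.IsGeneric.eq_of_prod_pow_eq {F : DiagonalContraction n}
    (hF : F.IsGeneric) {a b : Fin n → ℕ} (h : ∏ i, F.mult i ^ a i = ∏ i, F.mult i ^ b i) :
    a = b := by
  classical
  -- Cancel the common factor with exponents min(a, b). The remaining exponents are r = |a - b|, a
  -- sum of truncated differences, on the left for i in A and on the right otherwise.
  let A : Finset (Fin n) := Finset.univ.filter fun i => b i ≤ a i
  let r : Fin n → ℕ := fun i => (a i - b i) + (b i - a i)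
  let c : Fin n → ℕ := fun i => min (a i) (b i)
  have hc : ∏ i, F.mult i ^ c i ≠ 0 :=
    Finset.prod_ne_zero_iff.2 fun i _ => pow_ne_zero _ (F.mult_ne_zero i)
  have ha : ∏ i, F.mult i ^ a i = (∏ i ∈ A, F.mult i ^ r i) * ∏ i, F.mult i ^ c i := by
    rw [Finset.prod_filter, ← Finset.prod_mul_distrib]
    refine Finset.prod_congr rfl fun i _ => ?_
    by_cases hi : b i ≤ a i
    · rw [if_pos hi, ← pow_add]; congr 1; simp only [r, c]; omega
    · rw [if_neg hi, one_mul]; congr 1; simp only [c]; omega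
  have hb : ∏ i, F.mult i ^ b i = (∏ i ∈ Aᶜ, F.mult i ^ r i) * ∏ i, F.mult i ^ c i := by
    have : Aᶜ = Finset.univ.filter fun i => ¬b i ≤ a i := by ext i; simp [A]
    rw [this, Finset.prod_filter, ← Finset.prod_mul_distrib]
    refine Finset.prod_congr rfl fun i _ => ?_
    by_cases hi : b i ≤ a i
    · rw [if_neg (not_not.2 hi), one_mul]; congr 1; simp only [c]; omega
    · rw [if_pos hi, ← pow_add]; congr 1; simp only [r, c]; omega
  rw [ha, hb] at h
  have := hF.2 A Aᶜ r disjoint_compl_right (Finset.union_compl A) (mul_right_cancel₀ hc h)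
  funext i
  have := this i
  simp only [r] at this
  omega

/-- A holomorphic germ that is multiplied by a unit under a generic contraction is a monomial
times a unit. -/
theorem exists_eq_monomial_mul_unit [NeZero n] {F : DiagonalContraction n} (hF : F.IsGeneric)
    {g U : (Fin n → ℂ) → ℂ} (hg : HolAt g 0) (h0 : NonzeroGerm g 0) (hU : HolAt U 0)
    (hgU : ∀ᶠ z in 𝓝 0, g (F.linear z) = U z * g z) :
    ∃ (α : Fin n → ℕ) (q : (Fin n → ℂ) → ℂ), HolAt q 0 ∧ q 0 ≠ 0 ∧
      (∀ᶠ z in 𝓝 0, g z = (∏ i, z i ^ α i) * q z) ∧ U 0 = ∏ i, F.mult i ^ α i := by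
  classical
  obtain ⟨α, q, hq, hgq, hnz⟩ := exists_eq_monomial_mul hg h0 Finset.univ
  set μ := ∏ i, F.mult i ^ α i with hμ
  have hμ0 : μ ≠ 0 := Finset.prod_ne_zero_iff.2 fun i _ => pow_ne_zero _ (F.mult_ne_zero i)
  have hqF : (fun z => q (F.linear z)) =ᶠ[𝓝 0] fun z => μ⁻¹ * U z * q z := by
    refine eventuallyEq_of_mul_eq (Eventually.of_forall fun z =>
      nonzeroGerm_monomial Finset.univ α z) (hq.comp_clm_zero _)
      (((holAt_const _ _).mul hU).mul hq) ?_
    filter_upwards [hgU, hgq, (tendsto_clm_zero F.linear).eventually hgq] with z h1 h2 h3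
    rw [h2, h3] at h1
    simp only [F.linear_apply, mul_pow, Finset.prod_mul_distrib] at h1
    rw [← hμ] at h1
    field_simp
    linear_combination h1
  have hβ : ∀ k : Fin n, ∃ β : Fin n → ℕ, β k = 0 ∧ μ⁻¹ * U 0 = ∏ i, F.mult i ^ β i ∧
      (β = 0 → q 0 ≠ 0) := by
    intro k
    obtain ⟨β, h1, h2, h3⟩ := multiplier_of_coordProj F (Finset.univ.erase k)
      (fun z => q (coordProj (Finset.univ.erase k) z))
      (fun z => μ⁻¹ * U (coordProj (Finset.univ.erase k) z)) (hq.comp_clm_zero _)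
      (hnz k (Finset.mem_univ k)) ((holAt_const _ _).mul (hU.comp_clm_zero _)) (by
        filter_upwards [(tendsto_clm_zero (coordProj (Finset.univ.erase k))).eventually hqF]
          with z hz
        rw [coordProj_linear, hz]) (by
        refine Eventually.of_forall fun z => ?_
        rw [coordProj_comp, Finset.inter_self])
    exact ⟨β, h1 k (by simp), by simpa using h2, by simpa using h3⟩
  -- The same number μ⁻¹ U(0) is a monomial without μ_k, for every k. By independence all the β k
  -- coincide, so every entry is zero, and q(0) ≠ 0 follows.
  choose β hβk hβU hβ0 using hβ
  have hβz : β 0 = 0 := by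
    funext j
    have : β 0 = β j := hF.eq_of_prod_pow_eq ((hβU 0).symm.trans (hβU j))
    rw [this, hβk j]; rfl
  refine ⟨α, q, hq, hβ0 0 hβz, hgq, ?_⟩
  have := hβU 0
  rw [hβz] at this
  simp only [Pi.zero_apply, pow_zero, Finset.prod_const_one] at this
  rw [inv_mul_eq_iff_eq_mul₀ hμ0, mul_one] at this
  exact this

theorem DiagonalContraction.iterate_linear_apply (F : DiagonalContraction n) (N : ℕ)
    (z : Fin n → ℂ) (i : Fin n) : (F.linear^[N]) z i = F.mult i ^ N * z i := by
  induction N with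
  | zero => simp
  | succ N ih => rw [Function.iterate_succ_apply', F.linear_apply, ih, pow_succ']; ring

theorem DiagonalContraction.tendsto_iterate (F : DiagonalContraction n) (z : Fin n → ℂ) :
    Tendsto (fun N => (F.linear^[N]) z) atTop (𝓝 0) := by
  rw [tendsto_pi_nhds]
  intro i
  simp only [F.iterate_linear_apply]
  simpa using (tendsto_pow_atTop_nhds_zero_of_norm_lt_one (F.norm_mult_lt_one i)).mul_const (z i)

theorem DiagonalContraction.linear_mem_ball (F : DiagonalContraction n) {r : ℝ}
    {z : Fin n → ℂ} (hz : z ∈ ball (0 : Fin n → ℂ) r) : F.linear z ∈ ball (0 : Fin n → ℂ) r := by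
  have hr : 0 < r := pos_of_mem_ball hz
  rw [mem_ball_zero_iff, pi_norm_lt_iff hr] at hz ⊢
  intro i
  rw [F.linear_apply, norm_mul]
  exact (mul_le_of_le_one_left (norm_nonneg _) (F.norm_mult_lt_one i).le).trans_lt (hz i)

/-- An eigenfunction of a generic contraction is a monomial. -/
theorem eq_monomial_of_eigen [NeZero n] {F : DiagonalContraction n} (hF : F.IsGeneric)
    {g : (Fin n → ℂ) → ℂ} {ρ : ℂ} (hg : HolAt g 0) (h0 : NonzeroGerm g 0)
    (hgρ : ∀ᶠ z in 𝓝 0, g (F.linear z) = ρ * g z) :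
    ∃ (β : Fin n → ℕ) (c : ℂ), ρ = ∏ i, F.mult i ^ β i ∧ ∀ᶠ z in 𝓝 0, g z = c * ∏ i, z i ^ β i := by
  obtain ⟨β, q, hq, hq0, hgq, hρ⟩ := exists_eq_monomial_mul_unit hF hg h0 (holAt_const ρ 0) hgρ
  have hρ0 : ρ ≠ 0 := by
    rw [hρ]
    exact Finset.prod_ne_zero_iff.2 fun i _ => pow_ne_zero _ (F.mult_ne_zero i)
  -- The monomial absorbs the whole eigenvalue, so q is invariant; along the iterates, which tend to
  -- 0, q z = q 0.
  have hqF : (fun z => q (F.linear z)) =ᶠ[𝓝 0] q := by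
    refine eventuallyEq_of_mul_eq (Eventually.of_forall fun z =>
      nonzeroGerm_monomial Finset.univ β z) (hq.comp_clm_zero _) hq ?_
    filter_upwards [hgρ, hgq, (tendsto_clm_zero F.linear).eventually hgq] with z h1 h2 h3
    rw [h2, h3] at h1
    simp only [F.linear_apply, mul_pow, Finset.prod_mul_distrib] at h1
    rw [← hρ] at h1
    exact mul_left_cancel₀ hρ0 (by linear_combination h1)
  refine ⟨β, q 0, hρ, ?_⟩
  obtain ⟨r, hr, hball⟩ := Metric.eventually_nhds_iff_ball.1 hqF
  filter_upwards [ball_mem_nhds 0 hr, hgq] with z hz h1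
  have hit : ∀ N, (F.linear^[N]) z ∈ ball (0 : Fin n → ℂ) r ∧ q ((F.linear^[N]) z) = q z := by
    intro N
    induction N with
    | zero => exact ⟨hz, rfl⟩
    | succ N ih =>
      rw [Function.iterate_succ_apply']
      exact ⟨F.linear_mem_ball ih.1, (hball _ ih.1).trans ih.2⟩
  have hlim := hq.continuousAt.tendsto.comp (F.tendsto_iterate z)
  have : q z = q 0 := by
    refine tendsto_nhds_unique (tendsto_const_nhds.congr fun N => ?_) hlim
    exact (hit N).2.symm
  rw [h1, this, mul_comm]

/-- An effective divisor on `ℂⁿ ∖ {0}` that is invariant under a generic contraction is a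
combination of the coordinate hyperplanes. -/
theorem IsDivisor.eq_monomial (hn : 3 ≤ n) {F : DiagonalContraction n} (hF : F.IsGeneric)
    {B : (Fin n → ℂ) → (Fin n → ℂ) → ℂ} (hB : IsDivisor B {0}ᶜ)
    (hinv : ∀ p ≠ 0, Assoc (fun z => B (F.linear p) (F.linear z)) (B p) p) :
    ∃ α : Fin n → ℕ, ∀ p ≠ 0, Assoc (B p) (fun z => ∏ i, z i ^ α i) p := by
  have : NeZero n := ⟨by omega⟩
  obtain ⟨h, hh, hh0, hha⟩ := hB.exists_equation_at_zero hn
  have hFH : ∀ p, HolAt F.linear p := fun p => F.linear.differentiable.holAt p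
  have hassoc : ∀ᶠ z in 𝓝 0, z ≠ 0 → Assoc (fun z => h (F.linear z)) h z := by
    filter_upwards [hha, (tendsto_clm_zero F.linear).eventually hha] with z h1 h2 hz
    exact (((h2 (F.linear_ne_zero hz)).comp (hFH z)).trans (hinv z hz)).trans (h1 hz).symm
  -- Invariance is known only away from 0; Hartogs supplies the unit at 0, where the multiplier U(0)
  -- is read off.
  have hassoc0 : Assoc (fun z => h (F.linear z)) h 0 := by
    exact hartogs_assoc
      (ContinuousLinearMap.proj (R := ℂ) (φ := fun _ : Fin n => ℂ) ⟨0, by omega⟩)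
      (ContinuousLinearMap.proj (R := ℂ) (φ := fun _ : Fin n => ℂ) ⟨1, by omega⟩)
      (v := Pi.single ⟨0, by omega⟩ 1) (w := Pi.single ⟨1, by omega⟩ 1) (N := {0})
      (by simp) (by simp) (by simp) isClosed_singleton (by simp) (by simp)
      (hh.comp_clm_zero F.linear) hh hh0 (by simpa using hassoc)
  obtain ⟨U, hU, -, hhU⟩ := hassoc0
  obtain ⟨α, q, hq, hq0, hhq, -⟩ := exists_eq_monomial_mul_unit hF hh hh0 hU hhU
  refine ⟨α, ?_⟩
  have hmon : Assoc h (fun z => ∏ i, z i ^ α i) 0 :=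
    ⟨q, hq, hq0, hhq.mono fun z hz => by rw [hz, mul_comm]⟩
  have hnear : ∀ᶠ z in 𝓝 0, z ≠ 0 → Assoc (B z) (fun z => ∏ i, z i ^ α i) z := by
    filter_upwards [hha, hmon.eventually] with z h1 h2 hz
    exact (h1 hz).symm.trans h2
  -- Both divisors are invariant, so equality at f(p) pulls back to p. Every orbit enters the
  -- neighbourhood of 0 where equality is known.
  have hback : ∀ p ≠ 0, Assoc (B (F.linear p)) (fun z => ∏ i, z i ^ α i) (F.linear p) →
      Assoc (B p) (fun z => ∏ i, z i ^ α i) p := by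
    intro p hp hp'
    refine ((hinv p hp).symm.trans (hp'.comp (hFH p))).trans ?_
    refine ⟨fun _ => ∏ i, F.mult i ^ α i, holAt_const _ _,
      Finset.prod_ne_zero_iff.2 fun i _ => pow_ne_zero _ (F.mult_ne_zero i),
      Eventually.of_forall fun z => ?_⟩
    simp only [F.linear_apply, mul_pow, Finset.prod_mul_distrib]
  intro p hp
  obtain ⟨N, hN⟩ := ((F.tendsto_iterate p).eventually hnear).exists
  have hdesc : ∀ N, ∀ p : Fin n → ℂ, p ≠ 0 → ((F.linear^[N]) p ≠ 0 →
      Assoc (B ((F.linear^[N]) p)) (fun z => ∏ i, z i ^ α i) ((F.linear^[N]) p)) →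
      Assoc (B p) (fun z => ∏ i, z i ^ α i) p := by
    intro N
    induction N with
    | zero => intro p hp h; exact h hp
    | succ N ih =>
      intro p hp h
      exact hback p hp (ih _ (F.linear_ne_zero hp) h)
  exact hdesc N p hp hN

end Multiplier

/-! ### Exterior derivatives, logarithmic and monomial forms -/

section Forms

variable {n : ℕ}

theorem dOneForm_apply {ω : (Fin n → ℂ) → ((Fin n → ℂ) →L[ℂ] ℂ)} {z : Fin n → ℂ}
    (h : DifferentiableAt ℂ ω z) (v w : Fin n → ℂ) :
    dOneForm ω z ![v, w] = fderiv ℂ ω z v w - fderiv ℂ ω z w v := by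
  have hL : DifferentiableAt ℂ
      (fun x => ContinuousAlternatingMap.ofSubsingleton ℂ (Fin n → ℂ) ℂ (0 : Fin 1) (ω x)) z :=
    ((ContinuousAlternatingMap.ofSubsingletonLIE (𝕜 := ℂ) (E := Fin n → ℂ) (F := ℂ)
      (0 : Fin 1)).differentiable (ω z)).comp z h
  have happ : ∀ x : Fin n → ℂ, fderiv ℂ (fun y => ω y x) z = (fderiv ℂ ω z).flip x := fun x =>
    ((h.hasFDerivAt).clm_apply (hasFDerivAt_const x z)).fderiv.trans (by ext; simp)
  rw [dOneForm, extDeriv_apply hL]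
  simp [Fin.sum_univ_two, ContinuousAlternatingMap.ofSubsingleton_apply_apply, happ,
    Fin.removeNth, sub_eq_add_neg]

theorem dOneForm_congr {ω η : (Fin n → ℂ) → ((Fin n → ℂ) →L[ℂ] ℂ)} {z : Fin n → ℂ}
    (h : ω =ᶠ[𝓝 z] η) : dOneForm ω z = dOneForm η z := by
  unfold dOneForm
  refine Filter.EventuallyEq.extDeriv_eq ?_
  exact h.mono fun x hx => by simp only [hx]

/-- Multiplication by a function multiplies `ω ∧ dω` by its square. -/
theorem wedgeD_smul {ω : (Fin n → ℂ) → ((Fin n → ℂ) →L[ℂ] ℂ)} {g : (Fin n → ℂ) → ℂ}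
    {z : Fin n → ℂ} (hω : DifferentiableAt ℂ ω z) (hg : DifferentiableAt ℂ g z)
    (u v w : Fin n → ℂ) :
    wedgeD (fun x => g x • ω x) z u v w = g z ^ 2 * wedgeD ω z u v w := by
  have hd : ∀ a b, fderiv ℂ (fun x => g x • ω x) z a b =
      g z * fderiv ℂ ω z a b + fderiv ℂ g z a * ω z b := by
    intro a b
    rw [fderiv_fun_smul hg hω]
    simp
  have hs : DifferentiableAt ℂ (fun x => g x • ω x) z := hg.smul hω
  simp only [wedgeD, dOneForm_apply hω, dOneForm_apply hs, hd]
  simp only [_root_.smul_apply, smul_eq_mul]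
  ring

theorem wedgeD_congr {ω η : (Fin n → ℂ) → ((Fin n → ℂ) →L[ℂ] ℂ)} {z : Fin n → ℂ}
    (h : ω =ᶠ[𝓝 z] η) (u v w : Fin n → ℂ) : wedgeD ω z u v w = wedgeD η z u v w := by
  simp only [wedgeD, dOneForm_congr h, h.self_of_nhds]

/-- The logarithmic form `∑ cᵢ dzᵢ / zᵢ`. -/
noncomputable def logForm (c : Fin n → ℂ) (z : Fin n → ℂ) : (Fin n → ℂ) →L[ℂ] ℂ :=
  ∑ i, (c i * (z i)⁻¹) • ContinuousLinearMap.proj (R := ℂ) (φ := fun _ : Fin n => ℂ) i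

theorem hasFDerivAt_logForm (c : Fin n → ℂ) {z : Fin n → ℂ} (hz : ∀ i, z i ≠ 0) :
    HasFDerivAt (logForm c) (∑ i, ((c i * -(z i ^ 2)⁻¹) •
      ContinuousLinearMap.proj (R := ℂ) (φ := fun _ : Fin n => ℂ) i).smulRight
        (ContinuousLinearMap.proj (R := ℂ) (φ := fun _ : Fin n => ℂ) i)) z := by
  unfold logForm
  refine HasFDerivAt.fun_sum fun i _ => ?_
  have h1 : HasFDerivAt (fun x : Fin n → ℂ => x i)
      (ContinuousLinearMap.proj (R := ℂ) (φ := fun _ : Fin n => ℂ) i) z :=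
    (ContinuousLinearMap.proj (R := ℂ) (φ := fun _ : Fin n => ℂ) i).hasFDerivAt
  have h2 := ((hasDerivAt_inv (hz i)).comp_hasFDerivAt z h1).const_mul (c i)
  rw [smul_smul] at h2
  exact h2.smul_const (ContinuousLinearMap.proj (R := ℂ) (φ := fun _ : Fin n => ℂ) i)

theorem wedgeD_logForm (c : Fin n → ℂ) {z : Fin n → ℂ} (hz : ∀ i, z i ≠ 0)
    (u v w : Fin n → ℂ) : wedgeD (logForm c) z u v w = 0 := by
  have h := hasFDerivAt_logForm c hz
  have hsymm : ∀ a b, dOneForm (logForm c) z ![a, b] = 0 := by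
    intro a b
    rw [dOneForm_apply h.differentiableAt, h.fderiv]
    simp only [_root_.sum_apply, ContinuousLinearMap.smulRight_apply,
      _root_.smul_apply, ContinuousLinearMap.proj_apply, smul_eq_mul]
    rw [sub_eq_zero]
    exact Finset.sum_congr rfl fun i _ => by ring
  simp [wedgeD, hsymm]

theorem contDiff_monomialForm (c : Fin n → ℂ) (m : Fin n → ℕ) :
    ContDiff ℂ 1 (monomialForm c m) := by
  unfold monomialForm
  refine ContDiff.sum fun i _ => ?_
  have h1 : ContDiff ℂ 1 fun z : Fin n → ℂ => z i ^ (m i - 1) := (contDiff_apply ℂ ℂ i).pow _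
  have h2 : ContDiff ℂ 1 fun z : Fin n → ℂ => ∏ j ∈ Finset.univ.erase i, z j ^ m j :=
    contDiff_prod fun j _ => (contDiff_apply ℂ ℂ j).pow _
  exact (contDiff_const.mul (h1.mul h2)).smul contDiff_const

theorem pow_pred_mul_prod_erase {m : Fin n → ℕ} {z : Fin n → ℂ} {k : Fin n} (hz : z k ≠ 0)
    (hm : m k ≠ 0) :
    z k ^ (m k - 1) * ∏ j ∈ Finset.univ.erase k, z j ^ m j = (∏ j, z j ^ m j) * (z k)⁻¹ := by
  rw [← Finset.mul_prod_erase Finset.univ (fun j => z j ^ m j) (Finset.mem_univ k)]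
  obtain ⟨d, hd⟩ := Nat.exists_eq_succ_of_ne_zero hm
  rw [hd, Nat.succ_sub_one, pow_succ]
  field_simp

/-- Where no coordinate vanishes the form is z^m times the closed form ∑ c_i dz_i/z_i; the remaining
points follow by density and continuity. The condition on c is needed because the truncated exponent
m_i - 1 is wrong when m_i = 0. -/
theorem wedgeD_monomialForm {c : Fin n → ℂ} {m : Fin n → ℕ} (hcm : ∀ i, m i = 0 → c i = 0)
    (z u v w : Fin n → ℂ) : wedgeD (monomialForm c m) z u v w = 0 := by
  have hcd := contDiff_monomialForm c m
  have hdiff := hcd.differentiable one_ne_zero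
  have hcont : Continuous fun z => wedgeD (monomialForm c m) z u v w := by
    have h1 : Continuous (monomialForm c m) := hcd.continuous
    have h2 : Continuous (fderiv ℂ (monomialForm c m)) := hcd.continuous_fderiv one_ne_zero
    simp only [wedgeD, dOneForm_apply (hdiff _)]
    fun_prop
  refine (nonzeroGerm_monomial Finset.univ (fun _ => 1) z).cancel (g' := fun _ => 0)
    hcont.continuousAt continuousAt_const (Eventually.of_forall fun x => ?_)
  by_cases hx : ∀ i, x i ≠ 0
  · have heq : monomialForm c m =ᶠ[𝓝 x] fun y => (∏ j, y j ^ m j) • logForm c y := by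
      have hopen : ∀ᶠ y in 𝓝 x, ∀ i, y i ≠ 0 := by
        rw [eventually_all]
        exact fun i => (continuous_apply i).continuousAt.eventually_ne (hx i)
      filter_upwards [hopen] with y hy
      simp only [monomialForm, logForm, Finset.smul_sum, smul_smul]
      refine Finset.sum_congr rfl fun i _ => ?_
      congr 1
      by_cases hm : m i = 0
      · rw [hcm i hm]; simp
      · rw [pow_pred_mul_prod_erase (hy i) hm]; ring
    rw [wedgeD_congr heq, wedgeD_smul (hasFDerivAt_logForm c hx).differentiableAt (by fun_prop),
      wedgeD_logForm c hx]
    simp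
  · push Not at hx
    obtain ⟨i, hi⟩ := hx
    have : ∏ i, x i ^ 1 = 0 := Finset.prod_eq_zero (Finset.mem_univ i) (by simp [hi])
    simp only [this, mul_zero]

end Forms

/-! ### Open sets of the Hopf manifold lifted to ℂⁿ -/

section Lift

variable {n : ℕ} (F : DiagonalContraction n)

theorem DiagonalContraction.mem_lift {U : Set F.HopfManifold} {z : Fin n → ℂ} :
    z ∈ F.lift U ↔ ∃ hz : z ≠ 0, F.proj ⟨z, hz⟩ ∈ U := by
  constructor
  · rintro ⟨⟨w, hw⟩, h, rfl⟩
    exact ⟨hw, h⟩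
  · rintro ⟨hz, h⟩
    exact ⟨⟨z, hz⟩, h, rfl⟩

theorem DiagonalContraction.isOpen_lift (U : Opens F.HopfManifold) :
    IsOpen (F.lift (U : Set F.HopfManifold)) := by
  have h1 : Continuous F.proj := continuous_quotient_mk'
  have h2 : IsOpenEmbedding (Subtype.val : Punctured n → (Fin n → ℂ)) :=
    (isOpen_compl_singleton (x := (0 : Fin n → ℂ))).isOpenEmbedding_subtypeVal
  exact h2.isOpenMap _ (U.isOpen.preimage h1)

theorem DiagonalContraction.proj_linear {z : Fin n → ℂ} (hz : z ≠ 0) :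
    F.proj ⟨F.linear z, F.linear_ne_zero hz⟩ = F.proj ⟨z, hz⟩ := by
  refine Quotient.sound ?_
  change MulAction.orbitRel _ _ _ _
  rw [MulAction.orbitRel_apply]
  refine ⟨⟨F.perm, Subgroup.mem_zpowers _⟩, ?_⟩
  apply Subtype.ext
  funext i
  simp only [F.linear_apply]
  rfl

theorem DiagonalContraction.linear_mem_lift {U : Set F.HopfManifold} {z : Fin n → ℂ}
    (hz : z ∈ F.lift U) : F.linear z ∈ F.lift U := by
  obtain ⟨h0, h⟩ := F.mem_lift.1 hz
  exact F.mem_lift.2 ⟨F.linear_ne_zero h0, by rwa [F.proj_linear h0]⟩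

theorem DiagonalContraction.linear_single (k : Fin n) :
    F.linear (Pi.single k 1) = F.mult k • (Pi.single k 1 : Fin n → ℂ) := by
  ext i
  rw [F.linear_apply]
  by_cases h : i = k
  · subst h; simp
  · simp [h]

end Lift

/-! ### From local forms to one global eigenform -/

namespace CodimOneDistribution

variable {n : ℕ} {F : DiagonalContraction n} (D : CodimOneDistribution F)

/-- The open set of `ℂⁿ ∖ {0}` over the `i`-th chart. -/
def chart (i : D.ι) : Set (Fin n → ℂ) := F.lift (D.U i)

theorem isOpen_chart (i : D.ι) : IsOpen (D.chart i) := F.isOpen_lift _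

theorem ne_zero_of_mem_chart {i : D.ι} {z : Fin n → ℂ} (hz : z ∈ D.chart i) : z ≠ 0 :=
  (F.mem_lift.1 hz).1

theorem exists_mem_chart {z : Fin n → ℂ} (hz : z ≠ 0) : ∃ i, z ∈ D.chart i := by
  obtain ⟨i, hi⟩ := D.cover (F.proj ⟨z, hz⟩)
  exact ⟨i, F.mem_lift.2 ⟨hz, hi⟩⟩

/-- The `k`-th component of the `i`-th local form. -/
noncomputable def coeff (i : D.ι) (k : Fin n) (z : Fin n → ℂ) : ℂ := (D.form i).toFun z (Pi.single k 1)

theorem form_differentiableAt {i : D.ι} {z : Fin n → ℂ} (hz : z ∈ D.chart i) :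
    DifferentiableAt ℂ (D.form i).toFun z :=
  (D.form i).holomorphic.differentiableAt ((D.isOpen_chart i).mem_nhds hz)

theorem holAt_coeff {i : D.ι} (k : Fin n) {z : Fin n → ℂ} (hz : z ∈ D.chart i) :
    HolAt (D.coeff i k) z := by
  filter_upwards [(D.isOpen_chart i).mem_nhds hz] with w hw
  exact (D.form_differentiableAt hw).clm_apply (differentiableAt_const _)

/-- The local form is f-invariant and f scales the k-th basis vector by μ_k. -/
theorem coeff_linear {i : D.ι} (k : Fin n) {z : Fin n → ℂ} (hz : z ∈ D.chart i) :
    F.mult k * D.coeff i k (F.linear z) = D.coeff i k z := by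
  have := (D.form i).invariant z hz
  have h2 := congrArg (fun L => L (Pi.single k 1)) this
  simp only [ContinuousLinearMap.comp_apply, F.linear_single, map_smul, smul_eq_mul] at h2
  exact h2

theorem exists_transition (i j : D.ι) : ∃ ψ : (Fin n → ℂ) → ℂ,
    ∀ z, z ∈ D.chart i → z ∈ D.chart j → HolAt ψ z ∧ ψ z ≠ 0 ∧
      (D.form i).toFun z = ψ z • (D.form j).toFun z := by
  obtain ⟨g, ⟨ψ, hψ, hψg⟩, hg0, hg⟩ := D.transition i j
  refine ⟨ψ, fun z hzi hzj => ?_⟩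
  obtain ⟨h0, hi⟩ := F.mem_lift.1 hzi
  obtain ⟨_, hj⟩ := F.mem_lift.1 hzj
  refine ⟨?_, ?_, ?_⟩
  · refine HolAt.of_differentiableOn hψ (((D.isOpen_chart i).inter (D.isOpen_chart j)).mem_nhds
      ⟨hzi, hzj⟩ |> fun h => mem_of_superset h ?_)
    rintro w ⟨hwi, hwj⟩
    obtain ⟨h0, hi⟩ := F.mem_lift.1 hwi
    obtain ⟨_, hj⟩ := F.mem_lift.1 hwj
    exact F.mem_lift.2 ⟨h0, hi, hj⟩
  · have := hψg ⟨z, h0⟩ ⟨hi, hj⟩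
    rw [this]
    exact hg0 _ hi hj
  · have := hψg ⟨z, h0⟩ ⟨hi, hj⟩
    rw [this]
    exact hg ⟨z, h0⟩ hi hj

theorem assoc_coeff {i j : D.ι} (k : Fin n) {z : Fin n → ℂ} (hi : z ∈ D.chart i)
    (hj : z ∈ D.chart j) : Assoc (D.coeff i k) (D.coeff j k) z := by
  obtain ⟨ψ, hψ⟩ := D.exists_transition i j
  refine ⟨ψ, (hψ z hi hj).1, (hψ z hi hj).2.1, ?_⟩
  filter_upwards [(D.isOpen_chart i).mem_nhds hi, (D.isOpen_chart j).mem_nhds hj] with w h1 h2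
  simp only [coeff, (hψ w h1 h2).2.2]
  simp

theorem clm_ext_single {L L' : (Fin n → ℂ) →L[ℂ] ℂ}
    (h : ∀ k, L (Pi.single k 1) = L' (Pi.single k 1)) : L = L' := by
  apply ContinuousLinearMap.coe_injective
  refine LinearMap.pi_ext' fun k => ?_
  ext
  simpa using h k

/-- Some component of the local forms is nowhere the zero germ. -/
theorem exists_nonzeroGerm_coeff (hn : 2 ≤ n) :
    ∃ l : Fin n, ∀ i, ∀ z ∈ D.chart i, NonzeroGerm (D.coeff i l) z := by
  obtain ⟨i₀, z₀, hz₀, hne⟩ := D.nonzero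
  obtain ⟨l, hl⟩ : ∃ l, D.coeff i₀ l z₀ ≠ 0 := by
    by_contra hcon
    push Not at hcon
    exact hne (clm_ext_single fun k => by simpa [coeff] using hcon k)
  refine ⟨l, ?_⟩
  let T : Set (Fin n → ℂ) := {z | ∃ i, z ∈ D.chart i ∧ NonzeroGerm (D.coeff i l) z}
  have hT : IsOpen T := by
    rw [isOpen_iff_mem_nhds]
    rintro z ⟨i, hi, hnz⟩
    filter_upwards [(D.isOpen_chart i).mem_nhds hi, hnz.eventually (D.holAt_coeff l hi)]
      with w h1 h2 using ⟨i, h1, h2⟩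
  have hrank : 1 < Module.rank ℝ (Fin n → ℂ) := by
    rw [← Module.finrank_eq_rank, ← Module.finrank_mul_finrank ℝ ℂ (Fin n → ℂ),
      Complex.finrank_real_complex, Module.finrank_fin_fun]
    exact_mod_cast (by omega : 1 < 2 * n)
  -- `T` is open, and relatively closed because a zero germ in one chart stays zero nearby in every
  -- chart. Connectedness of ℂⁿ ∖ {0} gives the same index l everywhere.
  have hconn : IsPreconnected ({0}ᶜ : Set (Fin n → ℂ)) :=
    (isConnected_compl_singleton_of_one_lt_rank hrank 0).isPreconnected
  have hsub := hconn.subset_of_closure_inter_subset hT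
    ⟨z₀, D.ne_zero_of_mem_chart hz₀, i₀, hz₀, NonzeroGerm.of_ne hl
      (D.holAt_coeff l hz₀).continuousAt⟩ (by
      rintro z ⟨hzcl, hz0⟩
      obtain ⟨i, hi⟩ := D.exists_mem_chart hz0
      refine ⟨i, hi, ?_⟩
      by_contra hcon
      simp only [NonzeroGerm, not_frequently, not_not] at hcon
      obtain ⟨w, ⟨j, hj, hnz⟩, hw, hwi⟩ := ((mem_closure_iff_frequently.1 hzcl).and_eventually
        ((eventually_eventually_nhds.2 hcon).and ((D.isOpen_chart i).mem_nhds hi))).exists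
      exact (D.assoc_coeff l hwi hj).nonzeroGerm hnz (hw.mono fun x hx => not_not.2 hx))
  intro i z hz
  obtain ⟨j, hj, hnz⟩ := hsub (D.ne_zero_of_mem_chart hz)
  exact (D.assoc_coeff l hz hj).nonzeroGerm hnz

/-- After division by units, the local forms glue to a holomorphic form on `ℂⁿ ∖ {0}` with a
monomial component, which is an eigenvector of the contraction. -/
theorem exists_global_form (hn : 3 ≤ n) (hF : F.IsGeneric) :
    ∃ (l : Fin n) (α : Fin n → ℕ) (u : D.ι → (Fin n → ℂ) → ℂ)
      (η : (Fin n → ℂ) → ((Fin n → ℂ) →L[ℂ] ℂ)),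
      (∀ i, ∀ z ∈ D.chart i, HolAt (u i) z ∧ u i z ≠ 0 ∧ η z = (u i z)⁻¹ • (D.form i).toFun z) ∧
      ∀ k, ∀ z ≠ 0, F.mult k * η (F.linear z) (Pi.single k 1) =
        ((∏ i, F.mult i ^ α i) * F.mult l) * η z (Pi.single k 1) := by
  classical
  obtain ⟨l, hl⟩ := D.exists_nonzeroGerm_coeff (by omega)
  have : Nonempty D.ι := ⟨D.nonzero.choose⟩
  choose! idx hidx using fun z (hz : z ≠ 0) => D.exists_mem_chart (z := z) hz
  have hB : IsDivisor (fun p => D.coeff (idx p) l) {0}ᶜ :=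
    { holAt := fun p hp => D.holAt_coeff l (hidx p hp)
      nonzeroGerm := fun p hp => hl _ p (hidx p hp)
      compat := fun p hp => by
        filter_upwards [(D.isOpen_chart (idx p)).mem_nhds (hidx p hp),
          isOpen_compl_singleton.mem_nhds hp] with q h1 h2
        exact D.assoc_coeff l (hidx q h2) h1 }
  obtain ⟨α, hα⟩ := hB.eq_monomial hn hF (by
    intro p hp
    have h1 : F.linear p ∈ D.chart (idx p) := F.linear_mem_lift (hidx p hp)
    refine ((D.assoc_coeff l (hidx _ (F.linear_ne_zero hp)) h1).comp
      (F.linear.differentiable.holAt p)).trans ?_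
    refine ⟨fun _ => (F.mult l)⁻¹, holAt_const _ _, inv_ne_zero (F.mult_ne_zero l), ?_⟩
    filter_upwards [(D.isOpen_chart (idx p)).mem_nhds (hidx p hp)] with z hz
    rw [← D.coeff_linear l hz, inv_mul_cancel_left₀ (F.mult_ne_zero l)])
  have hmon := fun z : Fin n → ℂ => nonzeroGerm_monomial Finset.univ α z
  have hunit : ∀ i, ∃ u : (Fin n → ℂ) → ℂ, (∀ z ∈ D.chart i, HolAt u z) ∧
      ∀ z ∈ D.chart i, u z ≠ 0 ∧ D.coeff i l z = u z * ∏ j, z j ^ α j := fun i =>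
    exists_unit_of_assoc (D.isOpen_chart i) (fun z hz =>
      (D.assoc_coeff l hz (hidx z (D.ne_zero_of_mem_chart hz))).trans
        (hα z (D.ne_zero_of_mem_chart hz))) (fun z _ => hmon z)
  choose u hu hu' using hunit
  have hη : ∀ i j, ∀ z ∈ D.chart i, z ∈ D.chart j →
      (u j z)⁻¹ • (D.form j).toFun z = (u i z)⁻¹ • (D.form i).toFun z := by
    intro i j z hi hj
    obtain ⟨ψ, hψ⟩ := D.exists_transition j i
    -- Both units are the l-th coefficient divided by the same z^α, so they change by the transition
    -- function of the forms and the quotients agree.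
    have huψ : u j z = ψ z * u i z := by
      refine (hmon z).cancel (g' := fun z => ψ z * u i z) (hu j z hj).continuousAt
        ((hψ z hj hi).1.mul (hu i z hi)).continuousAt ?_
      filter_upwards [(D.isOpen_chart i).mem_nhds hi, (D.isOpen_chart j).mem_nhds hj] with w h1 h2
      rw [← (hu' j w h2).2, mul_assoc, ← (hu' i w h1).2]
      simp only [coeff, (hψ w h2 h1).2.2]
      simp
    rw [(hψ z hj hi).2.2, huψ, smul_smul]
    congr 1
    have := (hψ z hj hi).2.1
    have := (hu' i z hi).1
    field_simp
  refine ⟨l, α, u, fun z => (u (idx z) z)⁻¹ • (D.form (idx z)).toFun z, fun i z hz =>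
    ⟨hu i z hz, (hu' i z hz).1, hη i (idx z) z hz (hidx z (D.ne_zero_of_mem_chart hz))⟩, ?_⟩
  intro k z hz
  set i := idx z with hi
  have hzi : z ∈ D.chart i := hidx z hz
  have hFzi : F.linear z ∈ D.chart i := F.linear_mem_lift hzi
  have hFz := hη i (idx (F.linear z)) (F.linear z) hFzi (hidx _ (F.linear_ne_zero hz))
  simp only [hFz]
  -- Comparison of the l-th coefficient at z and at f(z): the factor μ_l comes from dz_l and μ^α
  -- from z^α. This fixes the eigenvalue for all the components.
  have huF : ((∏ i, F.mult i ^ α i) * F.mult l) * u i (F.linear z) = u i z := by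
    refine (hmon z).cancel (g := fun z => ((∏ i, F.mult i ^ α i) * F.mult l) * u i (F.linear z))
      ((holAt_const _ _).mul ((hu i _ hFzi).comp_clm F.linear)).continuousAt
      (hu i z hzi).continuousAt ?_
    filter_upwards [(D.isOpen_chart i).mem_nhds hzi] with w hw
    have hFw : F.linear w ∈ D.chart i := F.linear_mem_lift hw
    rw [← (hu' i w hw).2, ← D.coeff_linear l hw, (hu' i _ hFw).2]
    simp only [F.linear_apply, mul_pow, Finset.prod_mul_distrib]
    ring
  have h1 := D.coeff_linear k hzi
  simp only [coeff] at h1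
  simp only [_root_.smul_apply, smul_eq_mul]
  rw [← h1, ← huF]
  have h2 := (hu' i _ hFzi).1
  have h3 : (∏ i, F.mult i ^ α i) ≠ 0 :=
    Finset.prod_ne_zero_iff.2 fun i _ => pow_ne_zero _ (F.mult_ne_zero i)
  have h4 := F.mult_ne_zero l
  field_simp

end CodimOneDistribution

/-! ### Components of an eigenform -/

section Eigenform

variable {n : ℕ}

theorem prod_add_single (z : Fin n → ℂ) (α : Fin n → ℕ) (k : Fin n) :
    ∏ i, z i ^ (α + Pi.single k 1 : Fin n → ℕ) i = (∏ i, z i ^ α i) * z k := by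
  classical
  simp only [Pi.add_apply, pow_add, Finset.prod_mul_distrib]
  congr 1
  rw [Finset.prod_eq_single k]
  · simp
  · intro j _ hj; simp [hj]
  · simp

/-- A component of an eigenform of a generic contraction is a monomial. -/
theorem exists_monomial_of_eigen (hn : 2 ≤ n) {F : DiagonalContraction n} (hF : F.IsGeneric)
    {a : (Fin n → ℂ) → ℂ} (ha : ∀ z ≠ 0, DifferentiableAt ℂ a z) {m : Fin n → ℕ} (k : Fin n)
    (hak : ∀ z ≠ 0, F.mult k * a (F.linear z) = (∏ i, F.mult i ^ m i) * a z) :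
    ∃ c : ℂ, (m k = 0 → c = 0) ∧
      ∀ z ≠ 0, a z = c * (z k ^ (m k - 1) * ∏ j ∈ Finset.univ.erase k, z j ^ m j) := by
  have : NeZero n := ⟨by omega⟩
  obtain ⟨Φ, hΦ, hΦa⟩ := hartogs_point hn (φ := a) (Eventually.of_forall ha)
  set ρ := (F.mult k)⁻¹ * ∏ i, F.mult i ^ m i with hρ
  have hρ0 : ρ ≠ 0 := mul_ne_zero (inv_ne_zero (F.mult_ne_zero k))
    (Finset.prod_ne_zero_iff.2 fun i _ => pow_ne_zero _ (F.mult_ne_zero i))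
  have haρ : ∀ z ≠ 0, a (F.linear z) = ρ * a z := by
    intro z hz
    rw [hρ, mul_assoc, ← hak z hz, inv_mul_cancel_left₀ (F.mult_ne_zero k)]
  have hiter : ∀ N, ∀ z ≠ 0, (F.linear^[N]) z ≠ 0 ∧ a ((F.linear^[N]) z) = ρ ^ N * a z := by
    intro N z hz
    induction N with
    | zero => simpa using hz
    | succ N ih =>
      rw [Function.iterate_succ_apply']
      exact ⟨F.linear_ne_zero ih.1, by rw [haρ _ ih.1, ih.2, pow_succ']; ring⟩
  have hΦρ : (fun z => Φ (F.linear z)) =ᶠ[𝓝 0] fun z => ρ * Φ z := by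
    refine eventuallyEq_of_mul_eq (m := fun z : Fin n → ℂ => z k ^ 1)
      (Eventually.of_forall fun z => nonzeroGerm_coord_pow k 1 z) (hΦ.comp_clm_zero _)
      ((holAt_const _ _).mul hΦ) ?_
    filter_upwards [hΦa, (tendsto_clm_zero F.linear).eventually hΦa] with z h1 h2
    by_cases hz : z = 0
    · simp [hz]
    · rw [h1 hz, h2 (F.linear_ne_zero hz), haρ z hz]
  -- Two solutions of the eigenvalue equation that agree near 0 agree everywhere: move z close to 0
  -- by iterating f and cancel ρ^N.
  have hextend : ∀ b : (Fin n → ℂ) → ℂ, (∀ z, b (F.linear z) = ρ * b z) →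
      (∀ᶠ z in 𝓝 0, Φ z = b z) → ∀ z ≠ 0, a z = b z := by
    intro b hb hev z hz
    obtain ⟨N, h1, h2⟩ := ((F.tendsto_iterate z).eventually (hΦa.and hev)).exists
    have hbN : ∀ N, b ((F.linear^[N]) z) = ρ ^ N * b z := by
      intro N
      induction N with
      | zero => simp
      | succ N ih => rw [Function.iterate_succ_apply', hb, ih, pow_succ']; ring
    have h3 := (hiter N z hz)
    have h4 : ρ ^ N * a z = ρ ^ N * b z := by
      rw [← h3.2, ← hbN N, ← h1 h3.1, h2]
    exact mul_left_cancel₀ (pow_ne_zero N hρ0) h4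
  by_cases hnz : NonzeroGerm Φ 0
  · obtain ⟨β, c, hβ, hc⟩ := eq_monomial_of_eigen hF hΦ hnz hΦρ
    -- The eigenvalue is μ^β and also μ^m / μ_k, so independence forces m = β + e_k. In particular
    -- m_k ≥ 1, and a component with m_k = 0 must vanish.
    have hm : β + Pi.single k 1 = m := by
      refine hF.eq_of_prod_pow_eq ?_
      rw [prod_add_single, ← hβ, hρ, mul_comm, mul_inv_cancel_left₀ (F.mult_ne_zero k)]
    refine ⟨c, fun h => ?_, fun z hz => ?_⟩
    · rw [← hm] at h
      simp at h
    · rw [hextend (fun z => c * ∏ i, z i ^ β i) (fun z => ?_) hc z hz]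
      · rw [← Finset.mul_prod_erase Finset.univ (fun j => z j ^ β j) (Finset.mem_univ k), ← hm]
        congr 2
        · simp
        · refine Finset.prod_congr rfl fun j hj => ?_
          simp [Finset.ne_of_mem_erase hj]
      · simp only [F.linear_apply, mul_pow, Finset.prod_mul_distrib]
        rw [hβ]; ring
  · refine ⟨0, fun _ => rfl, fun z hz => ?_⟩
    simp only [NonzeroGerm, not_frequently, not_not] at hnz
    rw [hextend (fun _ => 0) (by simp) hnz z hz]
    simp

theorem monomialForm_single (c : Fin n → ℂ) (m : Fin n → ℕ) (z : Fin n → ℂ) (k : Fin n) :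
    monomialForm c m z (Pi.single k 1) =
      c k * (z k ^ (m k - 1) * ∏ j ∈ Finset.univ.erase k, z j ^ m j) := by
  classical
  simp only [monomialForm, _root_.sum_apply, _root_.smul_apply,
    ContinuousLinearMap.proj_apply, smul_eq_mul]
  rw [Finset.sum_eq_single k]
  · simp
  · intro j _ hj; simp [hj]
  · simp

end Eigenform

end Hopf

/-! ### Conclusion -/

theorem theorem4 {n : ℕ} (hn : 3 ≤ n) (F : Hopf.DiagonalContraction n) (hF : F.IsGeneric)
    (D : Hopf.CodimOneDistribution F) :
    D.IsIntegrable ∧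
    ∃ (c : Fin n → ℂ) (m : Fin n → ℕ), (∀ i, m i = 0 → c i = 0) ∧
      D.IsInducedBy (Hopf.monomialForm c m) ∧
      Hopf.IsIntegrableOn (Hopf.monomialForm c m) {z | z ≠ 0} := by
  obtain ⟨l, α, u, η, hu, hη⟩ := D.exists_global_form hn hF
  have hηd : ∀ z ≠ 0, DifferentiableAt ℂ η z := by
    intro z hz
    obtain ⟨i, hi⟩ := D.exists_mem_chart hz
    refine DifferentiableAt.congr_of_eventuallyEq
      (((hu i z hi).1.inv (hu i z hi).2.1).differentiableAt.smul (D.form_differentiableAt hi)) ?_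
    filter_upwards [(D.isOpen_chart i).mem_nhds hi] with w hw using (hu i w hw).2.2
  -- The exponent vector is m = α + e_l: the extra e_l accounts for dz_l, as η has l-th coefficient
  -- z^α = z^{m - e_l}.
  have hcomp := fun k => Hopf.exists_monomial_of_eigen (by omega) hF
    (a := fun z => η z (Pi.single k 1)) (fun z hz => (hηd z hz).clm_apply (differentiableAt_const _))
    (m := α + Pi.single l 1) k (fun z hz => by rw [hη k z hz, Hopf.prod_add_single])
  choose c hc0 hc using hcomp
  have hηm : ∀ z ≠ 0, η z = Hopf.monomialForm c (α + Pi.single l 1) z := fun z hz =>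
    Hopf.CodimOneDistribution.clm_ext_single fun k => by
      rw [Hopf.monomialForm_single]
      exact hc k z hz
  have hdiff := (Hopf.contDiff_monomialForm c (α + Pi.single l 1)).differentiable one_ne_zero
  have hform : ∀ i, ∀ z ∈ D.chart i, (D.form i).toFun z =
      u i z • Hopf.monomialForm c (α + Pi.single l 1) z := by
    intro i z hz
    rw [← hηm z (D.ne_zero_of_mem_chart hz), (hu i z hz).2.2, smul_smul,
      mul_inv_cancel₀ (hu i z hz).2.1, one_smul]
  refine ⟨?_, c, α + Pi.single l 1, hc0, ⟨hdiff.differentiableOn, fun i => ?_⟩, ?_⟩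
  · intro i z hz v₁ v₂ v₃
    have heq : (D.form i).toFun =ᶠ[𝓝 z]
        fun w => u i w • Hopf.monomialForm c (α + Pi.single l 1) w := by
      filter_upwards [(D.isOpen_chart i).mem_nhds hz] with w hw using hform i w hw
    rw [Hopf.wedgeD_congr heq, Hopf.wedgeD_smul (hdiff z) (hu i z hz).1.differentiableAt,
      Hopf.wedgeD_monomialForm hc0, mul_zero]
  · refine ⟨fun z => (u i z)⁻¹, fun z hz => ?_, fun z hz => ⟨inv_ne_zero (hu i z hz).2.1, ?_⟩⟩
    · exact ((hu i z hz).1.inv (hu i z hz).2.1).differentiableAt.differentiableWithinAt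
    · rw [← hηm z (D.ne_zero_of_mem_chart hz), (hu i z hz).2.2]
  · intro z _ v₁ v₂ v₃
    exact Hopf.wedgeD_monomialForm hc0 z v₁ v₂ v₃
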